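/- **Theorem G.1.** Let $\mathcal X\in\mathbb R^{s\times\cdots\times s}$ be a tensor of order $N$, let $A_1,\dots,A_N\in\mathbb R^{s\times R}$, and consider the $i$-th subproblem of CP-ALS, $\min_{A\in\mathbb R^{s\times R}}\|L_iA^T-R_i\|_F^2$, where $L_i=A_1\odot\cdots\odot A_{i-1}\odot A_{i+1}\odot\cdots\odot A_N$ (Khatri–Rao product) and $R_i=\mathcal X_{(i)}^T$ is the transposed $i$-th matricization of $\mathcal X$. Let $T$ be a contraction tree of the tensor network of $L_i$, that is, a binary tree whose leaves are the vertices $j\neq i$, each occurring once. Let $S_i\in\mathbb R^{m\times s^{N-1}}$ be the Gaussian tensor network embedding built on $T$: (a) the edge of size $s$ of every leaf $j$ is sketched by an $m\times s$ matrix; (b) at every contraction $(U,V)$ of $T$, with $U$ and $V$ already sketched to one dimension of size $m$ each, the sketch dimension of $V$ is written as a pair of dimensions of sizes $\alpha,\beta$ (with $\alpha\beta=m$, or $\alpha\beta\ge m$ with zero padding when sizes are rounded up); a tensor $v_1$, of row size $m$, is contracted with the sketch dimension of $U$ and the one of size $\alpha$, and a tensor $v_2$, of row size $m$, is contracted with the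 row dimension of $v_1$ and the one of size $\beta$, which leaves one dimension of size $m$. Every tensor has independent entries $\tfrac1{\sqrt m}\mathcal N(0,1)$, and all tensors are independent. The choice $\alpha,\beta\approx\sqrt m$ at every contraction is the cost-optimal one; the statement holds for every choice. Then for every $\delta_0<1$ there is a constant $C>0$, depending only on $\delta_0$, such that for all $N,R,s,i,\mathcal X,A_1,\dots,A_N$, all $\varepsilon\in(0,1]$ and $\delta\in(0,\delta_0]$, all $m\ge C\,NR\log(1/\delta)/\varepsilon^2$ and all $S_i$ as above, the following holds with probability at least $1-\delta$: the sketched problem $\min_A\|S_iL_iA^T-S_iR_i\|_F^2$ has a solution, and each of its solutions $\hat A$ is $(1+\varepsilon)$-accurate, that is, $$\|L_i\hat A^T-R_i\|_F^2\le(1+\varepsilon)\min_A\|L_iA^T-R_i\|_F^2 .$$ In particular a sketch size $m=\Theta(NR\log(1/\delta)/\varepsilon^2)$ suffices. -/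

import Mathlib

open MeasureTheory ProbabilityTheory

namespace CPALS

/-- Squared Frobenius norm of a real matrix. -/
def frobSq {κ τ : Type*} [Fintype κ] [Fintype τ] (M : Matrix κ τ ℝ) : ℝ :=
  ∑ x, ∑ y, M x y ^ 2

/-! ### The least squares subproblem of CP-ALS

The input tensor has order `N` and size `s × ⋯ × s`. The rows of the matrices of the `i`-th
subproblem are indexed by the multi-indices `(x_j)` with `j ≠ i`. -/

/-- The Khatri-Rao product `L_i = A_1 ⊙ ⋯ ⊙ A_{i-1} ⊙ A_{i+1} ⊙ ⋯ ⊙ A_N`: its `r`-th column is the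
Kronecker product of the `r`-th columns of the factor matrices `A_j`, `j ≠ i`. -/
def khatriRao {N s R : ℕ} (A : Fin N → Matrix (Fin s) (Fin R) ℝ) (i : Fin N) :
    Matrix ({j : Fin N // j ≠ i} → Fin s) (Fin R) ℝ :=
  Matrix.of fun x r => ∏ j : {j : Fin N // j ≠ i}, A j (x j) r

/-- The transpose `R_i` of the `i`-th matricization of the tensor `X`. -/
def matricizationT {N s : ℕ} (X : (Fin N → Fin s) → ℝ) (i : Fin N) :
    Matrix ({j : Fin N // j ≠ i} → Fin s) (Fin s) ℝ :=
  Matrix.of fun x t => X fun j => if h : j = i then t else x ⟨j, h⟩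

/-- The least squares objective `‖L Bᵀ - Y‖_F²` as a function of the unknown matrix `B`. -/
def lsqObj {κ : Type*} [Fintype κ] {s R : ℕ} (L : Matrix κ (Fin R) ℝ) (Y : Matrix κ (Fin s) ℝ)
    (B : Matrix (Fin s) (Fin R) ℝ) : ℝ :=
  frobSq (L * B.transpose - Y)

/-- `B` solves `min_B ‖L Bᵀ - Y‖_F²`. -/
def IsLsqSolution {κ : Type*} [Fintype κ] {s R : ℕ} (L : Matrix κ (Fin R) ℝ)
    (Y : Matrix κ (Fin s) ℝ) (B : Matrix (Fin s) (Fin R) ℝ) : Prop :=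
  ∀ B', lsqObj L Y B ≤ lsqObj L Y B'

/-- `B` is a `(1+ε)`-accurate solution of `min_B ‖L Bᵀ - Y‖_F²`: its objective value is at most
`1 + ε` times the minimum. -/
def IsLsqAccurate {κ : Type*} [Fintype κ] {s R : ℕ} (ε : ℝ) (L : Matrix κ (Fin R) ℝ)
    (Y : Matrix κ (Fin s) ℝ) (B : Matrix (Fin s) (Fin R) ℝ) : Prop :=
  ∀ B', lsqObj L Y B ≤ (1 + ε) * lsqObj L Y B'

/-! ### The tensor network embedding -/

/-- The graph of the embedding that the sketching algorithm builds on a contraction tree of a data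
tensor network all of whose vertices `j : ι` carry an edge to be sketched.

* `leaf j`: the data vertex `j`; its edge is sketched by one matrix (with `m` rows), a factor of
  the Kronecker product part of the embedding.
* `node l r α β e`: the contraction of the outputs `U` of `l` and `V` of `r`. Both have been
  sketched to one dimension of size `m`. They are sketched to one dimension of size `m` by a small
  network of two tensors `v₁`, `v₂`. The sketch dimension of `V` is viewed, through `e`, as a pair
  of edges of sizes `α` and `β`. The tensor `v₁` is joined to `U` (size `m`), to `V` (size `α`)
  and to `v₂` (size `m`); the tensor `v₂` is joined to `v₁` (size `m`), to `V` (size `β`) and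
  has the output edge (size `m`).

The algorithm takes `α = √(m c / b)` and `β = m / α`, where `c` and `b` are the sizes of the
dimensions of `V` alone and of the dimensions contracted between `U` and `V`. For a Khatri-Rao
product `b = c = 1`, so `α = β = √m`, up to rounding. All choices of `α` and `β` are
allowed here; `e` is a bijection when `α β = m`, and pads when sizes are rounded up. Interchanging
`l` and `r` gives the mirror image of the small network. -/
inductive SketchNetwork (ι : Type) (m : ℕ) : Type
  | leaf (j : ι) : SketchNetwork ι m
  | node (l r : SketchNetwork ι m) (α β : ℕ) (e : Fin m ↪ Fin α × Fin β) : SketchNetwork ι m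

/-- The law of a `p × κ` array of independent `N(0,1)` variables. -/
noncomputable def gaussianArray (p : ℕ) (κ : Type) [Fintype κ] : Measure (Fin p → κ → ℝ) :=
  Measure.pi fun _ => Measure.pi fun _ => gaussianReal 0 1

namespace SketchNetwork

variable {ι : Type} {m : ℕ}

/-- The data vertices at the leaves, from left to right. -/
def leaves : SketchNetwork ι m → List ι
  | leaf j => [j]
  | node l r _ _ _ => l.leaves ++ r.leaves

/-- The underlying binary tree is a contraction tree of the full set `ι` of data vertices: every
data vertex is at exactly one leaf. -/
def IsContractionTree (T : SketchNetwork ι m) : Prop :=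
  T.leaves.Nodup ∧ ∀ j, j ∈ T.leaves

/-- The values of all tensors of the embedding, before normalization, when the sketched edges have
size `s`. Each tensor is matricized: its first index is the row, that is the output edge or the
edge to the tensor that follows it, and its second index is the column. -/
def Sample (s : ℕ) : SketchNetwork ι m → Type
  | leaf _ => Fin m → Fin s → ℝ
  | node l r α β _ =>
      l.Sample s × r.Sample s × (Fin m → Fin m × Fin α → ℝ) × (Fin m → Fin m × Fin β → ℝ)

instance instMeasurableSpaceSample (s : ℕ) :
    (T : SketchNetwork ι m) → MeasurableSpace (T.Sample s)
  | leaf _ => inferInstanceAs (MeasurableSpace (Fin m → Fin s → ℝ))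
  | node l r α β _ =>
      letI := instMeasurableSpaceSample s l
      letI := instMeasurableSpaceSample s r
      inferInstanceAs (MeasurableSpace (l.Sample s × r.Sample s ×
        (Fin m → Fin m × Fin α → ℝ) × (Fin m → Fin m × Fin β → ℝ)))

/-- All entries of all tensors are independent `N(0,1)` variables. -/
noncomputable def law (s : ℕ) : (T : SketchNetwork ι m) → Measure (T.Sample s)
  | leaf _ => gaussianArray m (Fin s)
  | node l r α β _ => (l.law s).prod ((r.law s).prod
      ((gaussianArray m (Fin m × Fin α)).prod (gaussianArray m (Fin m × Fin β))))

/-- The contraction of the tensor network, as an array with the output index `o` and the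
multi-index `x` of the sketched edges. Every tensor is a Gaussian embedding `(1/√m) G`, where `m`
is the row size of its matricization. -/
noncomputable def contract (s : ℕ) :
    (T : SketchNetwork ι m) → T.Sample s → Fin m → (ι → Fin s) → ℝ
  | leaf j, G, o, x => (1 / √(m : ℝ)) * G o (x j)
  | node l r _ _ e, (Gl, Gr, G₁, G₂), o, x =>
      ∑ a : Fin m, ∑ b : Fin m, ∑ q : Fin m,
        l.contract s Gl a x * r.contract s Gr b x *
          ((1 / √(m : ℝ)) * G₁ q (a, (e b).1)) * ((1 / √(m : ℝ)) * G₂ o (q, (e b).2))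

/-- The embedding matrix `S`. -/
noncomputable def embedding (s : ℕ) (T : SketchNetwork ι m) (G : T.Sample s) :
    Matrix (Fin m) (ι → Fin s) ℝ :=
  Matrix.of fun o x => T.contract s G o x

end SketchNetwork

end CPALS

namespace CPALS

open scoped ENNReal InnerProductSpace

/-! ### Moments of a single Gaussian layer -/

/-! Concentration is proved through positive and negative moments, because these multiply along the
tree. One normalized Gaussian layer with `m` rows, applied to any fixed matrix, multiplies both `E
y^q` and `E y^(-q)` of the squared Frobenius norm `y` by at most `exp (4 q² / m)` (`layerBound_pow`,
`layerBound_inv_pow`). Every tensor of the network acts as such a layer on a matrix determined by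
independent tensors, and reshaping or padding between layers preserves the Frobenius norm.
Conditioning on one tensor after another therefore costs one factor per tensor
(`lintegral_contractIndex_le`), and there are at most `3 N` tensors.

For `y = ‖S x‖² / ‖x‖²`, Bernoulli's inequality gives `j |y - 1| ≤ max (y^j) (y^(-j))`. Moments of
order `± 2 p j` thus bound the `2p`-th moment of `y - 1` by `2 (e / j²)^p` as soon as `m ≥ 48 N p
j²` (`momentBound_linearEmbedding`). The dependence on `N` is linear since the exponents, not the
relative errors, add up.

This bound is used twice. With `p ~ R + log (1/δ)` and constant `j`, a net argument makes `S` a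
constant-distortion embedding of the column space of `L` (`measure_not_half_norm_sq_le`). With order
`q ~ log (1/δ)` and `k ~ √(R/ε)`, `S` nearly keeps the optimal residual orthogonal to that space
(`measure_sum_inner_sq_le`). On both events every sketched solution is accurate, deterministically
(`sum_norm_sq_le_of_sketch`). The two requirements on `m` are of order `N (R + log (1/δ))` and `N R
log (1/δ) / ε`, both within the assumed size; the constant depends on `δ₀` only because `log (1/δ) ≥
log (1/δ₀) > 0` has to absorb additive constants. -/

lemma lintegral_exp_sq_gaussianReal {t : ℝ} (ht : 2 * t < 1) :
    ∫⁻ x, ENNReal.ofReal (Real.exp (t * x ^ 2)) ∂(gaussianReal 0 1) =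
      ENNReal.ofReal (√(1 - 2 * t))⁻¹ := by
  have hpos : 0 < 1 - 2 * t := by linarith
  rw [gaussianReal_of_var_ne_zero _ one_ne_zero,
    lintegral_withDensity_eq_lintegral_mul _ (measurable_gaussianPDF 0 1) (by fun_prop)]
  have hpt : ∀ x : ℝ, (gaussianPDF 0 1 * fun x => ENNReal.ofReal (Real.exp (t * x ^ 2))) x =
      ENNReal.ofReal ((√(2 * Real.pi))⁻¹ * Real.exp (-(1 / 2 - t) * x ^ 2)) := by
    intro x
    rw [Pi.mul_apply, gaussianPDF, ← ENNReal.ofReal_mul (gaussianPDFReal_nonneg _ _ _),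
      gaussianPDFReal]
    simp only [NNReal.coe_one, mul_one, sub_zero]
    rw [mul_assoc, ← Real.exp_add]
    congr 3
    ring
  simp_rw [hpt]
  rw [← ofReal_integral_eq_lintegral_ofReal
      ((integrable_exp_neg_mul_sq (by linarith)).const_mul _)
      (Filter.Eventually.of_forall fun x => by positivity),
    integral_const_mul, integral_gaussian]
  congr 1
  rw [← Real.sqrt_inv, ← Real.sqrt_inv, ← Real.sqrt_mul (by positivity)]
  congr 1
  have : (1 / 2 - t) ≠ 0 := by linarith
  field_simp
-- Rotation invariance, read off from the variance of a linear functional under the standard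
-- Gaussian.
lemma map_sum_mul_pi_gaussianReal {κ : Type*} [Fintype κ] (u : κ → ℝ) (hu : ∑ x, u x ^ 2 = 1) :
    (Measure.pi fun _ : κ => gaussianReal 0 1).map (fun g => ∑ x, g x * u x) =
      gaussianReal 0 1 := by
  classical
  set L : StrongDual ℝ (EuclideanSpace ℝ κ) := innerSL ℝ (WithLp.toLp 2 u) with hL
  have hcomp : (fun g : κ → ℝ => ∑ x, g x * u x) = L ∘ (WithLp.toLp 2) := by
    ext g
    simp [hL, PiLp.inner_apply]
  rw [hcomp, ← Measure.map_map L.continuous.measurable (by fun_prop), map_pi_eq_stdGaussian,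
    IsGaussian.map_eq_gaussianReal, integral_strongDual_stdGaussian, variance_dual_stdGaussian]
  congr 1
  rw [hL, innerSL_apply_norm, EuclideanSpace.norm_sq_eq]
  simp [hu]

lemma lintegral_prod_pi {ι : Type*} [Fintype ι] {E : Type*} [MeasurableSpace E] (μ : Measure E)
    [IsProbabilityMeasure μ] (f : E → ℝ≥0∞) (hf : Measurable f) :
    ∫⁻ x, ∏ i : ι, f (x i) ∂(Measure.pi fun _ : ι => μ) = (∫⁻ x, f x ∂μ) ^ Fintype.card ι := by
  have h := lintegral_prod_eq_prod_lintegral_of_indepFun (μ := Measure.pi fun _ : ι => μ)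
    Finset.univ (fun (i : ι) (x : ι → E) => f (x i))
    (iIndepFun_pi (X := fun _ => f) (fun _ => hf.aemeasurable))
    (fun i => hf.comp (measurable_pi_apply i))
  rw [h, ← Finset.card_univ, ← Finset.prod_const]
  refine Finset.prod_congr rfl fun i _ => ?_
  exact (measurePreserving_eval (fun _ : ι => μ) i).lintegral_comp hf

lemma lintegral_exp_gaussianArray_unit {p : ℕ} {κ : Type} [Fintype κ] {t : ℝ} (ht : 2 * t < 1)
    (u : κ → ℝ) (hu : ∑ x, u x ^ 2 = 1) :
    ∫⁻ G, ENNReal.ofReal (Real.exp (t * ∑ o, (∑ x, G o x * u x) ^ 2)) ∂(gaussianArray p κ) =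
      ENNReal.ofReal (√(1 - 2 * t))⁻¹ ^ p := by
  have h1 : ∀ G : Fin p → κ → ℝ, ENNReal.ofReal (Real.exp (t * ∑ o, (∑ x, G o x * u x) ^ 2)) =
      ∏ o, ENNReal.ofReal (Real.exp (t * (∑ x, G o x * u x) ^ 2)) := by
    intro G
    rw [Finset.mul_sum, Real.exp_sum, ENNReal.ofReal_prod_of_nonneg fun _ _ => (Real.exp_pos _).le]
  simp_rw [h1]
  rw [gaussianArray, lintegral_prod_pi (Measure.pi fun _ : κ => gaussianReal 0 1)
    (fun g => ENNReal.ofReal (Real.exp (t * (∑ x, g x * u x) ^ 2))) (by fun_prop),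
    Fintype.card_fin, ← lintegral_exp_sq_gaussianReal ht]
  congr 1
  conv_rhs => rw [← map_sum_mul_pi_gaussianReal u hu]
  rw [lintegral_map (by fun_prop) (by fun_prop)]

/-- Jensen's inequality over the columns of `M`, weighted by their share of the Frobenius norm,
reduces to one unit vector; no diagonalization is needed. Both signs of `t` are allowed: positive
`t` serves the positive moments, negative `t` the inverse ones. -/
lemma lintegral_exp_gaussianArray_le {p : ℕ} {κ κ' : Type} [Fintype κ] [Fintype κ']
    (M : κ → κ' → ℝ) (v : ℝ) (hv : ∑ x, ∑ k, M x k ^ 2 = v) (hv0 : 0 < v)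
    {t : ℝ} (ht : 2 * (t * v) < 1) :
    ∫⁻ G, ENNReal.ofReal (Real.exp (t * ∑ o, ∑ k, (∑ x, G o x * M x k) ^ 2))
        ∂(gaussianArray p κ) ≤ ENNReal.ofReal (√(1 - 2 * (t * v)))⁻¹ ^ p := by
  set w : κ' → ℝ := fun k => ∑ x, M x k ^ 2 with hw
  have hw0 : ∀ k, 0 ≤ w k := fun k => Finset.sum_nonneg fun x _ => sq_nonneg _
  have hwsum : ∑ k, w k / v = 1 := by
    rw [← Finset.sum_div, hw, Finset.sum_comm, hv, div_self hv0.ne']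
  -- For a zero column `v / w k` is `0` by convention; harmless, as its weight and its contribution
  -- vanish too.
  set z : κ' → (Fin p → κ → ℝ) → ℝ := fun k G =>
    v / w k * (t * ∑ o, (∑ x, G o x * M x k) ^ 2) with hz
  have hconv : ∀ G : Fin p → κ → ℝ,
      ENNReal.ofReal (Real.exp (t * ∑ o, ∑ k, (∑ x, G o x * M x k) ^ 2)) ≤
        ∑ k, ENNReal.ofReal (w k / v) * ENNReal.ofReal (Real.exp (z k G)) := by
    intro G
    have h1 : t * ∑ o, ∑ k, (∑ x, G o x * M x k) ^ 2 = ∑ k, (w k / v) • z k G := by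
      rw [Finset.sum_comm, Finset.mul_sum]
      refine Finset.sum_congr rfl fun k _ => ?_
      rcases (hw0 k).eq_or_lt with h | h
      · have hM : ∀ x, M x k = 0 := fun x => by
          have := (Finset.sum_eq_zero_iff_of_nonneg fun x _ => sq_nonneg (M x k)).1 h.symm x
            (Finset.mem_univ x)
          exact pow_eq_zero_iff two_ne_zero |>.1 this
        simp [hM, ← h]
      · simp only [hz, smul_eq_mul]
        field_simp
    rw [h1]
    refine (ENNReal.ofReal_le_ofReal (convexOn_exp.map_sum_le
      (fun k _ => div_nonneg (hw0 k) hv0.le) hwsum fun _ _ => Set.mem_univ _)).trans_eq ?_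
    simp only [smul_eq_mul]
    rw [ENNReal.ofReal_sum_of_nonneg fun k _ =>
      mul_nonneg (div_nonneg (hw0 k) hv0.le) (Real.exp_pos _).le]
    exact Finset.sum_congr rfl fun k _ => ENNReal.ofReal_mul (div_nonneg (hw0 k) hv0.le)
  refine (lintegral_mono hconv).trans ?_
  rw [lintegral_finsetSum _ fun k _ => by fun_prop]
  have hterm : ∀ k, ∫⁻ G, ENNReal.ofReal (w k / v) * ENNReal.ofReal (Real.exp (z k G))
      ∂(gaussianArray p κ) ≤
      ENNReal.ofReal (w k / v) * ENNReal.ofReal (√(1 - 2 * (t * v)))⁻¹ ^ p := by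
    intro k
    rcases (hw0 k).eq_or_lt with h | h
    · simp [← h]
    · rw [lintegral_const_mul _ (by fun_prop)]
      gcongr
      have hs : √(w k) ^ 2 = w k := Real.sq_sqrt h.le
      have hs0 : √(w k) ≠ 0 := (Real.sqrt_pos.2 h).ne'
      have hu : ∑ x, (M x k / √(w k)) ^ 2 = 1 := by
        simp_rw [div_pow, hs]
        rw [← Finset.sum_div]
        exact div_self h.ne'
      rw [← lintegral_exp_gaussianArray_unit ht _ hu]
      refine lintegral_mono fun G => le_of_eq ?_
      simp only [hz]
      congr 2
      have : ∀ o, ∑ x, G o x * (M x k / √(w k)) = (∑ x, G o x * M x k) / √(w k) := fun o => by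
        rw [Finset.sum_div]
        exact Finset.sum_congr rfl fun x _ => by ring
      simp_rw [this, div_pow, hs]
      rw [← Finset.sum_div]
      ring
  refine (Finset.sum_le_sum fun k _ => hterm k).trans_eq ?_
  rw [← Finset.sum_mul, ← ENNReal.ofReal_sum_of_nonneg fun k _ => div_nonneg (hw0 k) hv0.le,
    hwsum, ENNReal.ofReal_one, one_mul]

instance isProbabilityMeasure_gaussianArray (p : ℕ) (κ : Type) [Fintype κ] :
    IsProbabilityMeasure (gaussianArray p κ) := by
  unfold gaussianArray; infer_instance

/-- A normalized Gaussian embedding with `m` rows, applied to any matrix, increases the expectation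
of the functional `F` of the squared Frobenius norm at most by the factor `c`. -/
def LayerBound (m : ℕ) (F : ℝ → ℝ≥0∞) (c : ℝ≥0∞) : Prop :=
  ∀ (κ κ' : Type) [Fintype κ] [Fintype κ'] (M : κ → κ' → ℝ),
    ∫⁻ G, F (∑ o, ∑ k, (∑ x, (1 / √(m : ℝ)) * G o x * M x k) ^ 2) ∂(gaussianArray m κ) ≤
      c * F (∑ x, ∑ k, M x k ^ 2)

lemma sum_sq_normalized {m : ℕ} {κ κ' : Type} [Fintype κ] [Fintype κ'] (G : Fin m → κ → ℝ)
    (M : κ → κ' → ℝ) :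
    ∑ o, ∑ k, (∑ x, (1 / √(m : ℝ)) * G o x * M x k) ^ 2 =
      (∑ o, ∑ k, (∑ x, G o x * M x k) ^ 2) / m := by
  simp_rw [Finset.sum_div]
  refine Finset.sum_congr rfl fun o _ => Finset.sum_congr rfl fun k _ => ?_
  have : ∑ x, (1 / √(m : ℝ)) * G o x * M x k = (∑ x, G o x * M x k) / √(m : ℝ) := by
    rw [Finset.sum_div]
    exact Finset.sum_congr rfl fun x _ => by ring
  rw [this, div_pow, Real.sq_sqrt (Nat.cast_nonneg m)]

lemma inv_sqrt_pow_le_exp {m : ℕ} {z : ℝ} (hz : 0 ≤ z) (hz' : z ≤ 1 / 2) :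
    (√(1 - z))⁻¹ ^ m ≤ Real.exp (m * (z + z ^ 2) / 2) := by
  have h1 : 0 < 1 - z := by linarith
  have h2 : (√(1 - z))⁻¹ ≤ Real.exp ((z + z ^ 2) / 2) := by
    rw [Real.exp_half, ← Real.sqrt_inv]
    refine Real.sqrt_le_sqrt ?_
    -- A polynomial form of `-log (1 - z) ≤ z + z²`, valid for `z ≤ 1/2`.
    have h3 : (1 - z)⁻¹ ≤ 1 + (z + z ^ 2) + (z + z ^ 2) ^ 2 / 2 := by
      rw [inv_le_iff_one_le_mul₀ h1]
      nlinarith [mul_nonneg hz hz, mul_nonneg (mul_nonneg hz hz) hz,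
        mul_nonneg (mul_nonneg hz hz) (mul_nonneg hz hz),
        mul_nonneg (mul_nonneg hz hz) (sub_nonneg.2 hz')]
    exact h3.trans (Real.quadratic_le_exp_of_nonneg (by positivity))
  refine (pow_le_pow_left₀ (by positivity) h2 m).trans_eq ?_
  rw [← Real.exp_nat_mul]
  congr 1
  ring

lemma eq_zero_of_sum_sq_eq_zero {κ κ' : Type} [Fintype κ] [Fintype κ'] {M : κ → κ' → ℝ}
    (h : ∑ x, ∑ k, M x k ^ 2 = 0) (x : κ) (k : κ') : M x k = 0 := by
  have h1 := (Finset.sum_eq_zero_iff_of_nonneg fun x _ =>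
    Finset.sum_nonneg fun k _ => sq_nonneg (M x k)).1 h x (Finset.mem_univ x)
  have h2 := (Finset.sum_eq_zero_iff_of_nonneg fun k _ => sq_nonneg (M x k)).1 h1 k
    (Finset.mem_univ k)
  exact pow_eq_zero_iff two_ne_zero |>.1 h2

/-- The power is dominated by an exponential through `x ≤ exp (x - 1)`, tangent at the typical value
`x = 1`. The resulting factor `exp (-q)` cancels the first-order term of the exponential moment,
leaving an exponent of order `q² / m`. -/
lemma layerBound_pow {m q : ℕ} (hm : 8 * q ≤ m) :
    LayerBound m (fun y => ENNReal.ofReal y ^ q)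
      (ENNReal.ofReal (Real.exp (4 * (q : ℝ) ^ 2 / m))) := by
  intro κ κ' _ _ M
  rcases Nat.eq_zero_or_pos q with rfl | hq
  · simp
  have hmpos : (0 : ℝ) < m := by exact_mod_cast (by omega : 0 < m)
  have hqm : (8 : ℝ) * q ≤ m := by exact_mod_cast hm
  set v := ∑ x, ∑ k, M x k ^ 2 with hv
  have hv0 : 0 ≤ v := Finset.sum_nonneg fun x _ => Finset.sum_nonneg fun k _ => sq_nonneg _
  rcases hv0.eq_or_lt with h | hvpos
  · have hM := eq_zero_of_sum_sq_eq_zero (hv ▸ h.symm)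
    simp [hM, hq.ne']
  simp_rw [sum_sq_normalized]
  have hpt : ∀ G : Fin m → κ → ℝ,
      ENNReal.ofReal ((∑ o, ∑ k, (∑ x, G o x * M x k) ^ 2) / m) ^ q ≤
        ENNReal.ofReal (v ^ q * Real.exp (-q)) *
        ENNReal.ofReal (Real.exp (q / (m * v) * ∑ o, ∑ k, (∑ x, G o x * M x k) ^ 2)) := by
    intro G
    set y := ∑ o, ∑ k, (∑ x, G o x * M x k) ^ 2 with hy
    have hy0 : 0 ≤ y := Finset.sum_nonneg fun x _ => Finset.sum_nonneg fun k _ => sq_nonneg _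
    rw [← ENNReal.ofReal_pow (by positivity), ← ENNReal.ofReal_mul (by positivity)]
    refine ENNReal.ofReal_le_ofReal ?_
    have h1 : y / m / v ≤ Real.exp (y / m / v - 1) := by
      have := Real.add_one_le_exp (y / m / v - 1)
      linarith
    have h2 := pow_le_pow_left₀ (by positivity) h1 q
    rw [← Real.exp_nat_mul] at h2
    calc (y / m) ^ q = v ^ q * (y / m / v) ^ q := by rw [← mul_pow]; congr 1; field_simp
      _ ≤ v ^ q * Real.exp (q * (y / m / v - 1)) := by gcongr
      _ = _ := by
        rw [mul_assoc, ← Real.exp_add]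
        congr 2
        field_simp
        ring
  refine (lintegral_mono hpt).trans ?_
  rw [lintegral_const_mul _ (by fun_prop)]
  have hz : (2 : ℝ) * (q / (m * v) * v) = 2 * q / m := by field_simp
  have hz2 : (2 : ℝ) * q / m ≤ 1 / 2 := by
    rw [div_le_iff₀ hmpos]; linarith
  have h := lintegral_exp_gaussianArray_le (p := m) M v hv.symm hvpos (t := q / (m * v))
    (by rw [hz]; linarith)
  refine (mul_le_mul_right h _).trans ?_
  rw [hz, ← ENNReal.ofReal_pow (by positivity), ← ENNReal.ofReal_pow hv0,
    ← ENNReal.ofReal_mul (by positivity), ← ENNReal.ofReal_mul (by positivity)]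
  refine ENNReal.ofReal_le_ofReal ?_
  refine (mul_le_mul_of_nonneg_left (inv_sqrt_pow_le_exp (by positivity) hz2)
    (by positivity)).trans ?_
  rw [mul_assoc, ← Real.exp_add, mul_comm]
  refine mul_le_mul_of_nonneg_right (Real.exp_le_exp.2 ?_) (by positivity)
  have : -(q : ℝ) + m * (2 * q / m + (2 * q / m) ^ 2) / 2 = 2 * q ^ 2 / m := by
    field_simp
    ring
  rw [this]
  gcongr
  norm_num

/-! ### Negative moments of one layer, by Laplace transforms -/

lemma lintegral_rpow_mul_exp_neg {a r : ℝ} (ha : 0 < a) (hr : 0 < r) :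
    ∫⁻ t in Set.Ioi (0 : ℝ), ENNReal.ofReal (t ^ (a - 1) * Real.exp (-(r * t))) =
      ENNReal.ofReal ((1 / r) ^ a * Real.Gamma a) := by
  have h := Real.integral_rpow_mul_exp_neg_mul_Ioi ha hr
  have hpos : 0 < (1 / r) ^ a * Real.Gamma a :=
    mul_pos (Real.rpow_pos_of_pos (by positivity) _) (Real.Gamma_pos_of_pos ha)
  have hint : IntegrableOn (fun t : ℝ => t ^ (a - 1) * Real.exp (-(r * t))) (Set.Ioi 0) := by
    by_contra hc
    rw [integral_undef hc] at h
    exact hpos.ne h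
  rw [← h, ofReal_integral_eq_lintegral_ofReal hint]
  filter_upwards [self_mem_ae_restrict measurableSet_Ioi] with t ht
  exact mul_nonneg (Real.rpow_nonneg (le_of_lt ht) _) (Real.exp_pos _).le

/-- This is the Gamma integral, which turns an inverse power into a mixture of exponentials. The
case `y = 0` is included: the integral then diverges. -/
lemma ofReal_inv_pow_le_lintegral {n : ℕ} {y : ℝ} (hy : 0 ≤ y) :
    (ENNReal.ofReal y)⁻¹ ^ (n + 1) ≤ ENNReal.ofReal (1 / (n.factorial : ℝ)) *
      ∫⁻ t in Set.Ioi (0 : ℝ), ENNReal.ofReal (t ^ n * Real.exp (-(y * t))) := by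
  rcases hy.eq_or_lt with rfl | hy
  · have : ∫⁻ t in Set.Ioi (0 : ℝ), ENNReal.ofReal (t ^ n * Real.exp (-(0 * t))) = ⊤ := by
      rw [eq_top_iff]
      calc ⊤ = ∫⁻ t in Set.Ioi (1 : ℝ), (1 : ℝ≥0∞) := by simp
        _ ≤ ∫⁻ t in Set.Ioi (1 : ℝ), ENNReal.ofReal (t ^ n * Real.exp (-(0 * t))) := by
          refine setLIntegral_mono (by fun_prop) fun t ht => ?_
          rw [← ENNReal.ofReal_one]
          refine ENNReal.ofReal_le_ofReal ?_
          simpa using one_le_pow₀ (le_of_lt ht)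
        _ ≤ _ := lintegral_mono_set (Set.Ioi_subset_Ioi zero_le_one)
    rw [this, ENNReal.mul_top]
    · exact le_top
    · simp [Nat.factorial_pos]
  · have h := lintegral_rpow_mul_exp_neg (a := n + 1) (by positivity) hy
    simp only [add_sub_cancel_right, Real.rpow_natCast] at h
    rw [h, Real.Gamma_nat_eq_factorial, ← ENNReal.ofReal_mul (by positivity),
      ← ENNReal.ofReal_inv_of_pos hy, ← ENNReal.ofReal_pow (by positivity)]
    refine ENNReal.ofReal_le_ofReal (le_of_eq ?_)
    have hf : (n.factorial : ℝ) ≠ 0 := by positivity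
    rw [show (n : ℝ) + 1 = ((n + 1 : ℕ) : ℝ) by push_cast; ring, Real.rpow_natCast]
    field_simp

lemma Gamma_sub_nat_mul_pow_le {a : ℝ} (q : ℕ) (h : (q : ℝ) < a) :
    Real.Gamma (a - q) * (a - q) ^ q ≤ Real.Gamma a := by
  induction q with
  | zero => simp
  | succ q ih =>
    push_cast at h ⊢
    have h1 := ih (by linarith)
    have h2 : Real.Gamma (a - q) = (a - (q + 1)) * Real.Gamma (a - (q + 1)) := by
      rw [← Real.Gamma_add_one (by linarith)]
      congr 1; ring
    rw [h2] at h1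
    refine le_trans ?_ h1
    have h3 : 0 < Real.Gamma (a - (q + 1)) := Real.Gamma_pos_of_pos (by linarith)
    have h4 : (a - (q + 1)) ^ q ≤ (a - q) ^ q :=
      pow_le_pow_left₀ (by linarith) (by linarith) q
    calc _ = (a - (q + 1)) * Real.Gamma (a - (q + 1)) * (a - (q + 1)) ^ q := by ring
      _ ≤ _ := mul_le_mul_of_nonneg_left h4 (mul_nonneg (by linarith) h3.le)

lemma inv_sqrt_pow_eq_rpow {m : ℕ} {x : ℝ} (hx : 0 < x) :
    (√x)⁻¹ ^ m = (1 / x) ^ ((m : ℝ) / 2) := by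
  rw [← Real.sqrt_inv, Real.sqrt_eq_rpow, ← Real.rpow_mul_natCast (by positivity), one_div x]
  congr 1
  ring

/-- In essence the inverse moment of a chi-square variable. Writing `(1 + s t)^(-a)`, `a = m / 2`,
as a Gamma mixture of `exp (-s u t)` and exchanging the integrals yields `n! s^(-q) Γ(a - q) /
Γ(a)`; the Gamma ratio is at most `(a - q)^(-q)`. -/
lemma lintegral_pow_mul_inv_sqrt_pow_le {m n : ℕ} (hm : 8 * (n + 1) ≤ m) {v : ℝ} (hv : 0 < v) :
    ∫⁻ t in Set.Ioi (0 : ℝ), ENNReal.ofReal (t ^ n) *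
        ENNReal.ofReal (√(1 - 2 * (-(t / m) * v)))⁻¹ ^ m ≤
      ENNReal.ofReal (n.factorial * Real.exp (4 * ((n + 1 : ℕ) : ℝ) ^ 2 / m) / v ^ (n + 1)) := by
  have hmpos : (0 : ℝ) < m := by exact_mod_cast (by omega : 0 < m)
  have hqm : (8 : ℝ) * (n + 1 : ℕ) ≤ m := by exact_mod_cast hm
  set q : ℕ := n + 1 with hq
  set a : ℝ := (m : ℝ) / 2 with ha
  have ha0 : 0 < a := by positivity
  have hq1 : (1 : ℝ) ≤ q := by exact_mod_cast (by omega : 1 ≤ q)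
  have haq : (q : ℝ) < a := by rw [ha]; linarith
  have hGa : 0 < Real.Gamma a := Real.Gamma_pos_of_pos ha0
  set s : ℝ := v / a with hs
  have hs0 : 0 < s := by positivity
  have hlap : ∀ t ∈ Set.Ioi (0 : ℝ), ENNReal.ofReal (t ^ n) *
      ENNReal.ofReal (√(1 - 2 * (-(t / m) * v)))⁻¹ ^ m =
      ENNReal.ofReal (1 / Real.Gamma a) * ∫⁻ u in Set.Ioi (0 : ℝ),
        ENNReal.ofReal (u ^ (a - 1) * Real.exp (-u)) *
          ENNReal.ofReal (t ^ n * Real.exp (-(s * u * t))) := by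
    intro t ht
    have ht0 : (0 : ℝ) < t := ht
    have h1 : 1 - 2 * (-(t / m) * v) = 1 + s * t := by
      rw [hs, ha]; field_simp; ring
    have h2 : 0 < 1 + s * t := by positivity
    rw [h1, ← ENNReal.ofReal_pow (by positivity), inv_sqrt_pow_eq_rpow h2, ← ha]
    have h3 := lintegral_rpow_mul_exp_neg ha0 h2
    have h4 : ∫⁻ u in Set.Ioi (0 : ℝ), ENNReal.ofReal (u ^ (a - 1) * Real.exp (-u)) *
          ENNReal.ofReal (t ^ n * Real.exp (-(s * u * t))) =
        ENNReal.ofReal (t ^ n) * ENNReal.ofReal ((1 / (1 + s * t)) ^ a * Real.Gamma a) := by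
      rw [← h3, ← lintegral_const_mul _ (by fun_prop)]
      refine setLIntegral_congr_fun measurableSet_Ioi fun u hu => ?_
      have hu0 : (0 : ℝ) < u := hu
      rw [← ENNReal.ofReal_mul (by positivity), ← ENNReal.ofReal_mul (by positivity)]
      congr 1
      have : Real.exp (-((1 + s * t) * u)) = Real.exp (-u) * Real.exp (-(s * u * t)) := by
        rw [← Real.exp_add]; congr 1; ring
      rw [this]; ring
    rw [h4, mul_left_comm, ← ENNReal.ofReal_mul (show 0 ≤ 1 / Real.Gamma a by positivity)]
    congr 2
    field_simp
  rw [setLIntegral_congr_fun measurableSet_Ioi hlap, lintegral_const_mul', lintegral_lintegral_swap]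
  rotate_left
  · fun_prop
  · exact ENNReal.ofReal_ne_top
  have hin : ∀ u ∈ Set.Ioi (0 : ℝ), ∫⁻ t in Set.Ioi (0 : ℝ),
      ENNReal.ofReal (u ^ (a - 1) * Real.exp (-u)) *
          ENNReal.ofReal (t ^ n * Real.exp (-(s * u * t))) =
      ENNReal.ofReal (n.factorial / s ^ q) *
        ENNReal.ofReal (u ^ (a - q - 1) * Real.exp (-(1 * u))) := by
    intro u hu
    have hu0 : (0 : ℝ) < u := hu
    rw [lintegral_const_mul _ (by fun_prop)]
    have h := lintegral_rpow_mul_exp_neg (a := q) (r := s * u) (by positivity) (by positivity)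
    have hqn : (q : ℝ) - 1 = n := by rw [hq]; push_cast; ring
    simp only [hqn, Real.rpow_natCast] at h
    have hG : Real.Gamma q = n.factorial := by
      rw [hq]; push_cast; exact Real.Gamma_nat_eq_factorial n
    rw [h, hG, ← ENNReal.ofReal_mul (by positivity), ← ENNReal.ofReal_mul (by positivity)]
    congr 1
    have h5 : u ^ (a - 1) = u ^ (a - q - 1) * u ^ q := by
      rw [← Real.rpow_natCast, ← Real.rpow_add hu0]; congr 1; ring
    rw [h5, one_mul, one_div, inv_pow, mul_pow]
    field_simp
  rw [setLIntegral_congr_fun measurableSet_Ioi hin, lintegral_const_mul _ (by fun_prop),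
    lintegral_rpow_mul_exp_neg (by linarith) one_pos, div_one, Real.one_rpow, one_mul,
    ← ENNReal.ofReal_mul (by positivity), ← ENNReal.ofReal_mul (by positivity)]
  refine ENNReal.ofReal_le_ofReal ?_
  have hg := Gamma_sub_nat_mul_pow_le q haq
  have haq0 : 0 < a - q := by linarith
  have hratio : (a / (a - q)) ^ q ≤ Real.exp (4 * (q : ℝ) ^ 2 / m) := by
    have h6 : a / (a - q) ≤ Real.exp (4 * q / m) := by
      refine le_trans ?_ (Real.add_one_le_exp _)
      rw [div_le_iff₀ haq0, ha]
      have : (4 * (q : ℝ) / m + 1) * (m / 2 - q) = m / 2 + q * (1 - 4 * q / m) := by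
        field_simp; ring
      rw [this]
      have : 4 * (q : ℝ) / m ≤ 1 := by rw [div_le_iff₀ hmpos]; linarith
      nlinarith
    refine (pow_le_pow_left₀ (by positivity) h6 q).trans_eq ?_
    rw [← Real.exp_nat_mul]; congr 1; ring
  have h7 : Real.Gamma (a - q) ≤ Real.Gamma a / (a - q) ^ q := by
    rw [le_div_iff₀ (by positivity)]; exact hg
  calc 1 / Real.Gamma a * (n.factorial / s ^ q * Real.Gamma (a - q))
      ≤ 1 / Real.Gamma a * (n.factorial / s ^ q * (Real.Gamma a / (a - q) ^ q)) := by gcongr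
    _ = n.factorial * (a / (a - q)) ^ q / v ^ q := by
      rw [hs, div_pow v, div_pow a]; field_simp
    _ ≤ _ := by gcongr

/-- The inverse power is a mixture of decaying exponentials, so after Tonelli only the exponential
moment at the negative parameter `-(t / m)` is needed. For `M = 0` the right-hand side is infinite.
-/
lemma layerBound_inv_pow {m q : ℕ} (hm : 8 * q ≤ m) :
    LayerBound m (fun y => (ENNReal.ofReal y)⁻¹ ^ q)
      (ENNReal.ofReal (Real.exp (4 * (q : ℝ) ^ 2 / m))) := by
  intro κ κ' _ _ M
  rcases q with _ | n
  · simp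
  have hmpos : (0 : ℝ) < m := by exact_mod_cast (by omega : 0 < m)
  set v := ∑ x, ∑ k, M x k ^ 2 with hv
  have hv0 : 0 ≤ v := Finset.sum_nonneg fun x _ => Finset.sum_nonneg fun k _ => sq_nonneg _
  rcases hv0.eq_or_lt with h | hvpos
  · simp only [← h, ENNReal.ofReal_zero, ENNReal.inv_zero]
    rw [ENNReal.top_pow (by omega), ENNReal.mul_top]
    · exact le_top
    · simp [Real.exp_pos]
  simp_rw [sum_sq_normalized]
  set Y : (Fin m → κ → ℝ) → ℝ := fun G => ∑ o, ∑ k, (∑ x, G o x * M x k) ^ 2 with hY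
  have hY0 : ∀ G, 0 ≤ Y G := fun G =>
    Finset.sum_nonneg fun x _ => Finset.sum_nonneg fun k _ => sq_nonneg _
  have hYm : Measurable Y := by fun_prop
  calc ∫⁻ G, (ENNReal.ofReal (Y G / m))⁻¹ ^ (n + 1) ∂(gaussianArray m κ)
      ≤ ∫⁻ G, (ENNReal.ofReal (1 / (n.factorial : ℝ)) * ∫⁻ t in Set.Ioi (0 : ℝ),
          ENNReal.ofReal (t ^ n * Real.exp (-(Y G / m * t)))) ∂(gaussianArray m κ) :=
        lintegral_mono fun G => ofReal_inv_pow_le_lintegral (div_nonneg (hY0 G) hmpos.le)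
    _ = ENNReal.ofReal (1 / (n.factorial : ℝ)) * ∫⁻ t in Set.Ioi (0 : ℝ),
          ∫⁻ G, ENNReal.ofReal (t ^ n * Real.exp (-(Y G / m * t))) ∂(gaussianArray m κ) := by
        rw [lintegral_const_mul' _ _ ENNReal.ofReal_ne_top, lintegral_lintegral_swap]
        fun_prop
    _ ≤ ENNReal.ofReal (1 / (n.factorial : ℝ)) * ∫⁻ t in Set.Ioi (0 : ℝ),
          ENNReal.ofReal (t ^ n) * ENNReal.ofReal (√(1 - 2 * (-(t / m) * v)))⁻¹ ^ m := by
        refine mul_le_mul_right (setLIntegral_mono' measurableSet_Ioi fun t ht => ?_) _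
        have ht0 : (0 : ℝ) < t := ht
        have h := lintegral_exp_gaussianArray_le (p := m) M v hv.symm hvpos (t := -(t / m))
          (by have : 0 < t / m * v := by positivity
              linarith)
        refine le_trans (le_of_eq ?_) (mul_le_mul_right h _)
        rw [← lintegral_const_mul _ (by fun_prop)]
        refine lintegral_congr fun G => ?_
        rw [← ENNReal.ofReal_mul (by positivity)]
        congr 3
        simp only [hY]
        ring
    _ ≤ ENNReal.ofReal (1 / (n.factorial : ℝ)) * ENNReal.ofReal (n.factorial *
          Real.exp (4 * ((n + 1 : ℕ) : ℝ) ^ 2 / m) / v ^ (n + 1)) :=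
        mul_le_mul_right (lintegral_pow_mul_inv_sqrt_pow_le hm hvpos) _
    _ = _ := by
        rw [← ENNReal.ofReal_inv_of_pos hvpos, ← ENNReal.ofReal_pow (by positivity),
          ← ENNReal.ofReal_mul (by positivity), ← ENNReal.ofReal_mul (by positivity)]
        congr 1
        have hf : (n.factorial : ℝ) ≠ 0 := by positivity
        rw [inv_pow]
        field_simp

/-! ### The contraction along the tree -/

namespace SketchNetwork

variable {ι : Type} {m : ℕ}

/-- The multi-indices of the sketched edges, arranged along the tree. -/
def Index (s : ℕ) : SketchNetwork ι m → Type
  | leaf _ => Fin s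
  | node l r _ _ _ => l.Index s × r.Index s

instance instFintypeIndex (s : ℕ) : (T : SketchNetwork ι m) → Fintype (T.Index s)
  | leaf _ => inferInstanceAs (Fintype (Fin s))
  | node l r _ _ _ =>
      letI := instFintypeIndex s l
      letI := instFintypeIndex s r
      inferInstanceAs (Fintype (l.Index s × r.Index s))

/-- The indices at the leaves of the tree that a multi-index determines. -/
def toIndex (s : ℕ) : (T : SketchNetwork ι m) → (ι → Fin s) → T.Index s
  | leaf j, x => x j
  | node l r _ _ _, x => (l.toIndex s x, r.toIndex s x)

lemma apply_eq_of_toIndex_eq (s : ℕ) (T : SketchNetwork ι m) {x y : ι → Fin s}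
    (h : T.toIndex s x = T.toIndex s y) : ∀ j ∈ T.leaves, x j = y j := by
  induction T with
  | leaf j =>
    intro k hk
    rw [leaves, List.mem_singleton] at hk
    subst hk
    exact h
  | node l r _ _ _ ihl ihr =>
    intro k hk
    have h' : (l.toIndex s x, r.toIndex s x) = (l.toIndex s y, r.toIndex s y) := h
    rw [Prod.mk.injEq] at h'
    rw [leaves, List.mem_append] at hk
    exact hk.elim (ihl h'.1 k) (ihr h'.2 k)

lemma IsContractionTree.toIndex_injective {T : SketchNetwork ι m} (hT : T.IsContractionTree)
    (s : ℕ) : Function.Injective (T.toIndex s) :=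
  fun _ _ h => funext fun j => T.apply_eq_of_toIndex_eq s h j (hT.2 j)

/-- The contraction of the tensor network as an array indexed along the tree. -/
noncomputable def contractIndex (s : ℕ) :
    (T : SketchNetwork ι m) → T.Sample s → Fin m → T.Index s → ℝ
  | leaf _, G, o, x => (1 / √(m : ℝ)) * G o x
  | node l r _ _ e, (Gl, Gr, G₁, G₂), o, (x, y) =>
      ∑ a : Fin m, ∑ b : Fin m, ∑ q : Fin m,
        l.contractIndex s Gl a x * r.contractIndex s Gr b y *
          ((1 / √(m : ℝ)) * G₁ q (a, (e b).1)) * ((1 / √(m : ℝ)) * G₂ o (q, (e b).2))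

lemma contract_eq_contractIndex (s : ℕ) (T : SketchNetwork ι m) (G : T.Sample s) (o : Fin m)
    (x : ι → Fin s) : T.contract s G o x = T.contractIndex s G o (T.toIndex s x) := by
  induction T generalizing o with
  | leaf j => rfl
  | node l r α β e ihl ihr =>
    obtain ⟨Gl, Gr, G₁, G₂⟩ := G
    simp only [contract, contractIndex, toIndex, ihl, ihr]

/-- The number of tensors of the embedding. -/
def size : SketchNetwork ι m → ℕ
  | leaf _ => 1
  | node l r _ _ _ => l.size + r.size + 2

lemma size_pos (T : SketchNetwork ι m) : 0 < T.size := by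
  cases T <;> simp [size]

/-- A binary tree has one contraction fewer than leaves, and each contraction carries two tensors.
-/
lemma size_add_two (T : SketchNetwork ι m) : T.size + 2 = 3 * T.leaves.length := by
  induction T with
  | leaf j => rfl
  | node l r _ _ _ ihl ihr => simp only [size, leaves, List.length_append]; omega

lemma IsContractionTree.size_le [Fintype ι] {T : SketchNetwork ι m}
    (hT : T.IsContractionTree) : T.size ≤ 3 * Fintype.card ι := by
  have h := T.size_add_two
  have := hT.1.length_le_card
  omega

instance isProbabilityMeasure_law (s : ℕ) :
    (T : SketchNetwork ι m) → IsProbabilityMeasure (T.law s)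
  | leaf _ => isProbabilityMeasure_gaussianArray m (Fin s)
  | node l r α β _ =>
      letI := isProbabilityMeasure_law s l
      letI := isProbabilityMeasure_law s r
      inferInstanceAs (IsProbabilityMeasure ((l.law s).prod ((r.law s).prod
        ((gaussianArray m (Fin m × Fin α)).prod (gaussianArray m (Fin m × Fin β))))))

lemma measurable_contract (s : ℕ) (T : SketchNetwork ι m) (o : Fin m) (x : ι → Fin s) :
    Measurable fun G : T.Sample s => T.contract s G o x := by
  induction T generalizing o with
  | leaf j =>
    change Measurable fun G : Fin m → Fin s → ℝ => (1 / √(m : ℝ)) * G o (x j)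
    fun_prop
  | node l r α β e ihl ihr =>
    change Measurable fun G : l.Sample s × r.Sample s ×
        (Fin m → Fin m × Fin α → ℝ) × (Fin m → Fin m × Fin β → ℝ) =>
      ∑ a : Fin m, ∑ b : Fin m, ∑ q : Fin m,
        l.contract s G.1 a x * r.contract s G.2.1 b x *
          ((1 / √(m : ℝ)) * G.2.2.1 q (a, (e b).1)) *
          ((1 / √(m : ℝ)) * G.2.2.2 o (q, (e b).2))
    refine Finset.measurable_sum _ fun a _ => Finset.measurable_sum _ fun b _ =>
      Finset.measurable_sum _ fun q _ => ?_
    have h1 : Measurable fun G : l.Sample s × r.Sample s ×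
        (Fin m → Fin m × Fin α → ℝ) × (Fin m → Fin m × Fin β → ℝ) => l.contract s G.1 a x :=
      (ihl a).comp measurable_fst
    have h2 : Measurable fun G : l.Sample s × r.Sample s ×
        (Fin m → Fin m × Fin α → ℝ) × (Fin m → Fin m × Fin β → ℝ) => r.contract s G.2.1 b x :=
      (ihr b).comp (measurable_fst.comp measurable_snd)
    refine ((h1.mul h2).mul ?_).mul ?_ <;> fun_prop

lemma sum_comp_embedding {A B : Type} [Fintype A] [Fintype B] [DecidableEq B] (e : A ↪ B)
    (f : A → ℝ) (g : B → ℝ) :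
    ∑ b, g b * (∑ a, if e a = b then f a else 0) = ∑ a, g (e a) * f a := by
  simp_rw [Finset.mul_sum, mul_ite, mul_zero]
  rw [Finset.sum_comm]
  simp

/-- The inner sum is extension by zero along `e`. That it is isometric is why any choice of `α`, `β`
is harmless. -/
lemma sum_sq_extend {A B : Type} [Fintype A] [Fintype B] [DecidableEq B] (e : A ↪ B)
    (f : A → ℝ) :
    ∑ b, (∑ a, if e a = b then f a else 0) ^ 2 = ∑ a, f a ^ 2 := by
  simp_rw [sq]
  rw [sum_comp_embedding]
  refine Finset.sum_congr rfl fun a _ => ?_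
  have : ∑ a', (if e a' = e a then f a' else 0) = f a := by
    rw [Finset.sum_eq_single a (fun b _ hb => if_neg (e.injective.ne hb)) (by simp), if_pos rfl]
  rw [this]

/-- Applying the embedding to any matrix increases the expectation of a functional of the squared
Frobenius norm at most by one factor per tensor. -/
lemma lintegral_contractIndex_le (s : ℕ) {F : ℝ → ℝ≥0∞} {c : ℝ≥0∞} (hF : LayerBound m F c) (hc : c ≠ ⊤)
    (T : SketchNetwork ι m) (κ : Type) [Fintype κ] (M : T.Index s → κ → ℝ) :
    ∫⁻ G, F (∑ o, ∑ k, (∑ x, T.contractIndex s G o x * M x k) ^ 2) ∂(T.law s) ≤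
      c ^ T.size * F (∑ x, ∑ k, M x k ^ 2) := by
  induction T generalizing κ with
  | leaf j =>
    rw [size, pow_one]
    exact hF (Fin s) κ M
  | node l r α β e ihl ihr =>
    -- The stages of applying the network to `M`: left subtree, right subtree, splitting of the
    -- sketch dimension with padding, then `v₁`. At each stage the indices not yet touched, or
    -- already sketched but not acted on, are moved into the columns; this is why the induction
    -- keeps `κ` general.
    let M₁ : l.Sample s → r.Index s → Fin m × κ → ℝ := fun Gl y p =>
      ∑ x, l.contractIndex s Gl p.1 x * M (x, y) p.2
    let M₂ : l.Sample s → r.Sample s → Fin m → Fin m × κ → ℝ := fun Gl Gr b p =>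
      ∑ y, r.contractIndex s Gr b y * M₁ Gl y p
    let M₃ : l.Sample s → r.Sample s → Fin m × Fin α → Fin β × κ → ℝ := fun Gl Gr u w =>
      ∑ b, if e b = (u.2, w.1) then M₂ Gl Gr b (u.1, w.2) else 0
    let M₄ : l.Sample s → r.Sample s → (Fin m → Fin m × Fin α → ℝ) →
        Fin m × Fin β → κ → ℝ := fun Gl Gr G₁ q k =>
      ∑ u, (1 / √(m : ℝ)) * G₁ q.1 u * M₃ Gl Gr u (q.2, k)
    have hM : ∀ Gl Gr G₁ G₂ o k,
        ∑ x, (node l r α β e).contractIndex s (Gl, Gr, G₁, G₂) o x * M x k =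
          ∑ q, (1 / √(m : ℝ)) * G₂ o q * M₄ Gl Gr G₁ q k := by
      intro Gl Gr G₁ G₂ o k
      change ∑ p : l.Index s × r.Index s, (∑ a : Fin m, ∑ b : Fin m, ∑ q : Fin m,
        l.contractIndex s Gl a p.1 * r.contractIndex s Gr b p.2 *
          ((1 / √(m : ℝ)) * G₁ q (a, (e b).1)) * ((1 / √(m : ℝ)) * G₂ o (q, (e b).2))) *
          M (p.1, p.2) k = _
      have hR : ∀ q a, ∑ y' : Fin β, ∑ z : Fin α, (1 / √(m : ℝ)) * G₂ o (q, y') *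
          ((1 / √(m : ℝ)) * G₁ q (a, z) * M₃ Gl Gr (a, z) (y', k)) =
          ∑ b, (1 / √(m : ℝ)) * G₂ o (q, (e b).2) * ((1 / √(m : ℝ)) * G₁ q (a, (e b).1)) *
            M₂ Gl Gr b (a, k) := by
        intro q a
        rw [← sum_comp_embedding e (fun b => M₂ Gl Gr b (a, k))
          (fun u => (1 / √(m : ℝ)) * G₂ o (q, u.2) * ((1 / √(m : ℝ)) * G₁ q (a, u.1))),
          Fintype.sum_prod_type_right]
        simp only [M₃, mul_assoc]
      have hR' : ∑ q, (1 / √(m : ℝ)) * G₂ o q * M₄ Gl Gr G₁ q k =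
          ∑ q, ∑ a, ∑ b, (1 / √(m : ℝ)) * G₂ o (q, (e b).2) *
            ((1 / √(m : ℝ)) * G₁ q (a, (e b).1)) * M₂ Gl Gr b (a, k) := by
        simp_rw [← hR, M₄, Fintype.sum_prod_type, Finset.mul_sum]
        exact Finset.sum_congr rfl fun q _ => Finset.sum_comm
      rw [hR']
      simp_rw [M₂, M₁, Finset.sum_mul, Finset.mul_sum]
      rw [Finset.sum_comm]
      conv_rhs => rw [Finset.sum_comm]
      refine Finset.sum_congr rfl fun a _ => ?_
      rw [Finset.sum_comm]
      conv_rhs => rw [Finset.sum_comm]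
      refine Finset.sum_congr rfl fun b _ => ?_
      rw [Finset.sum_comm]
      refine Finset.sum_congr rfl fun q _ => ?_
      rw [Fintype.sum_prod_type_right]
      refine Finset.sum_congr rfl fun y _ => Finset.sum_congr rfl fun x _ => ?_
      ring
    have hM₃ : ∀ Gl Gr, ∑ u, ∑ w, M₃ Gl Gr u w ^ 2 = ∑ b, ∑ p, M₂ Gl Gr b p ^ 2 := by
      intro Gl Gr
      simp only [Fintype.sum_prod_type]
      rw [Finset.sum_comm (s := (Finset.univ : Finset (Fin m)))]
      have h : ∀ a k, ∑ z : Fin α, ∑ y' : Fin β, M₃ Gl Gr (a, z) (y', k) ^ 2 =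
          ∑ b, M₂ Gl Gr b (a, k) ^ 2 := by
        intro a k
        rw [← sum_sq_extend e fun b => M₂ Gl Gr b (a, k), Fintype.sum_prod_type]
      calc ∑ z : Fin α, ∑ a : Fin m, ∑ y' : Fin β, ∑ k, M₃ Gl Gr (a, z) (y', k) ^ 2
          = ∑ a : Fin m, ∑ k, ∑ z : Fin α, ∑ y' : Fin β, M₃ Gl Gr (a, z) (y', k) ^ 2 := by
            rw [Finset.sum_comm]
            refine Finset.sum_congr rfl fun a _ => ?_
            rw [Finset.sum_comm (s := (Finset.univ : Finset κ))]
            exact Finset.sum_congr rfl fun z _ => Finset.sum_comm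
        _ = ∑ a : Fin m, ∑ k, ∑ b, M₂ Gl Gr b (a, k) ^ 2 := by simp_rw [h]
        _ = _ := by
            conv_rhs => rw [Finset.sum_comm]
            exact Finset.sum_congr rfl fun a _ => Finset.sum_comm
    have hM₁ : ∀ Gl, ∑ y, ∑ p, M₁ Gl y p ^ 2 =
        ∑ a, ∑ w : r.Index s × κ, (∑ x, l.contractIndex s Gl a x * M (x, w.1) w.2) ^ 2 := by
      intro Gl
      simp only [Fintype.sum_prod_type]
      rw [Finset.sum_comm]
    have hnorm : ∑ x, ∑ w : r.Index s × κ, M (x, w.1) w.2 ^ 2 =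
        ∑ x, ∑ k, M x k ^ 2 := by
      change _ = ∑ x : l.Index s × r.Index s, ∑ k, M x k ^ 2
      simp only [Fintype.sum_prod_type]
    calc ∫⁻ G, F (∑ o, ∑ k, (∑ x, (node l r α β e).contractIndex s G o x * M x k) ^ 2)
          ∂((node l r α β e).law s)
        ≤ ∫⁻ Gl, ∫⁻ Gr, ∫⁻ G₁, ∫⁻ G₂, F (∑ o, ∑ k,
            (∑ q, (1 / √(m : ℝ)) * G₂ o q * M₄ Gl Gr G₁ q k) ^ 2)
            ∂(gaussianArray m (Fin m × Fin β)) ∂(gaussianArray m (Fin m × Fin α))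
            ∂(r.law s) ∂(l.law s) := by
          -- Only this inequality of Tonelli's theorem is needed, and it requires no measurability
          -- of `F`. The tensors are then integrated out from the output inwards: `v₂`, `v₁`, right
          -- subtree, left subtree.
          refine (lintegral_prod_le _).trans (lintegral_mono fun Gl => ?_)
          refine (lintegral_prod_le _).trans (lintegral_mono fun Gr => ?_)
          refine (lintegral_prod_le _).trans (lintegral_mono fun G₁ => lintegral_mono fun G₂ => ?_)
          simp_rw [← hM]
          exact le_rfl
      _ ≤ ∫⁻ Gl, ∫⁻ Gr, ∫⁻ G₁, c * F (∑ q, ∑ k, M₄ Gl Gr G₁ q k ^ 2)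
            ∂(gaussianArray m (Fin m × Fin α)) ∂(r.law s) ∂(l.law s) :=
          lintegral_mono fun Gl => lintegral_mono fun Gr => lintegral_mono fun G₁ => hF _ _ _
      _ ≤ ∫⁻ Gl, ∫⁻ Gr, c * (c * F (∑ b, ∑ p, M₂ Gl Gr b p ^ 2)) ∂(r.law s) ∂(l.law s) := by
          refine lintegral_mono fun Gl => lintegral_mono fun Gr => ?_
          have h : ∀ G₁, ∑ q, ∑ k, M₄ Gl Gr G₁ q k ^ 2 = ∑ q : Fin m, ∑ w : Fin β × κ,
              (∑ u, (1 / √(m : ℝ)) * G₁ q u * M₃ Gl Gr u w) ^ 2 := fun G₁ => by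
            simp only [Fintype.sum_prod_type, M₄]
          simp_rw [h, ← hM₃]
          rw [lintegral_const_mul' _ _ hc]
          exact mul_le_mul_right (hF _ _ _) _
      _ ≤ ∫⁻ Gl, c * (c * (c ^ r.size * F (∑ y, ∑ p, M₁ Gl y p ^ 2))) ∂(l.law s) := by
          refine lintegral_mono fun Gl => ?_
          rw [lintegral_const_mul' _ _ hc, lintegral_const_mul' _ _ hc]
          exact mul_le_mul_right (mul_le_mul_right (ihr _ _) _) _
      _ ≤ c * (c * (c ^ r.size * (c ^ l.size *
            F (∑ x, ∑ w : r.Index s × κ, M (x, w.1) w.2 ^ 2)))) := by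
          simp_rw [hM₁]
          rw [lintegral_const_mul' _ _ hc, lintegral_const_mul' _ _ hc,
            lintegral_const_mul' _ _ (ENNReal.pow_ne_top hc)]
          exact mul_le_mul_right (mul_le_mul_right (mul_le_mul_right (ihl _ _) _) _) _
      _ = _ := by
          rw [hnorm, size]
          ring

end SketchNetwork

/-! ### Moments of the embedding of a vector -/

/-- The random linear map `S` preserves the squared norm of each fixed vector up to a relative
error whose moment of order `2 p` is at most `D`. -/
def MomentBound {Ω E F : Type*} [MeasurableSpace Ω] [NormedAddCommGroup E] [InnerProductSpace ℝ E]
    [NormedAddCommGroup F] [InnerProductSpace ℝ F] (μ : Measure Ω) (S : Ω → E →ₗ[ℝ] F) (p : ℕ)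
    (D : ℝ) : Prop :=
  ∀ x, ∫⁻ ω, ENNReal.ofReal ((‖S ω x‖ ^ 2 - ‖x‖ ^ 2) ^ (2 * p)) ∂μ ≤
    ENNReal.ofReal (D * (‖x‖ ^ 2) ^ (2 * p))

/-- Bernoulli's inequality for `y` if `y ≥ 1` and for `1 / y` if `y ≤ 1`, where `1 - y ≤ 1 / y - 1`.
At `y = 0` the inverse power is infinite. -/
lemma mul_sub_one_pow_le {y : ℝ} (hy : 0 ≤ y) (p j : ℕ) (hpj : 0 < 2 * p * j) :
    ENNReal.ofReal ((j * (y - 1)) ^ (2 * p)) ≤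
      ENNReal.ofReal y ^ (2 * p * j) + (ENNReal.ofReal y)⁻¹ ^ (2 * p * j) := by
  rcases le_total 1 y with h | h
  · refine le_trans ?_ le_self_add
    rw [← ENNReal.ofReal_pow hy]
    refine ENNReal.ofReal_le_ofReal ?_
    have h1 : (j : ℝ) * (y - 1) ≤ y ^ j := by
      have := one_add_mul_le_pow (a := y - 1) (by linarith) j
      rw [add_sub_cancel] at this
      linarith
    rw [mul_comm (2 * p) j, pow_mul y j]
    exact pow_le_pow_left₀ (mul_nonneg (Nat.cast_nonneg j) (by linarith)) h1 _
  · refine le_trans ?_ le_add_self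
    rcases hy.eq_or_lt with rfl | hy
    · rw [ENNReal.ofReal_zero, ENNReal.inv_zero, ENNReal.top_pow hpj.ne']
      exact le_top
    · rw [← ENNReal.ofReal_inv_of_pos hy, ← ENNReal.ofReal_pow (by positivity)]
      refine ENNReal.ofReal_le_ofReal ?_
      have h2 : 1 - y ≤ y⁻¹ - 1 := by
        have h3 : y + y⁻¹ - 2 = (y - 1) ^ 2 * y⁻¹ := by field_simp; ring
        have : 0 ≤ (y - 1) ^ 2 * y⁻¹ := by positivity
        linarith
      have h1 : (j : ℝ) * (1 - y) ≤ y⁻¹ ^ j := by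
        have := one_add_mul_le_pow (a := y⁻¹ - 1) (by linarith) j
        rw [add_sub_cancel] at this
        nlinarith [(Nat.cast_nonneg j : (0 : ℝ) ≤ j)]
      have h4 : ((j : ℝ) * (y - 1)) ^ (2 * p) = (j * (1 - y)) ^ (2 * p) := by
        rw [← Even.neg_pow (even_two_mul p)]
        congr 1; ring
      rw [h4, mul_comm (2 * p) j, pow_mul y⁻¹ j]
      exact pow_le_pow_left₀ (mul_nonneg (Nat.cast_nonneg j) (by linarith)) h1 _

/-- The gain is the denominator `j ^ (2 * p)`: control of moments of order `± 2 p j` up to a factor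
`C` forces relative deviations of order `1 / j`. -/
lemma lintegral_sub_pow_le {Ω : Type*} [MeasurableSpace Ω] {μ : Measure Ω} {Z : Ω → ℝ}
    (hZ : ∀ ω, 0 ≤ Z ω) (hZm : Measurable Z) {v C : ℝ} (hv : 0 < v) (hC : 0 ≤ C) {p j : ℕ}
    (hp : 0 < p) (hj : 0 < j)
    (h1 : ∫⁻ ω, ENNReal.ofReal (Z ω) ^ (2 * p * j) ∂μ ≤
      ENNReal.ofReal C * ENNReal.ofReal v ^ (2 * p * j))
    (h2 : ∫⁻ ω, (ENNReal.ofReal (Z ω))⁻¹ ^ (2 * p * j) ∂μ ≤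
      ENNReal.ofReal C * (ENNReal.ofReal v)⁻¹ ^ (2 * p * j)) :
    ∫⁻ ω, ENNReal.ofReal ((Z ω - v) ^ (2 * p)) ∂μ ≤
      ENNReal.ofReal (2 * C / (j : ℝ) ^ (2 * p) * v ^ (2 * p)) := by
  set n := 2 * p * j with hn
  have hn0 : 0 < n := by positivity
  have hjR : (0 : ℝ) < j := by exact_mod_cast hj
  have hv0 : ENNReal.ofReal v ≠ 0 := by simpa using hv
  have hpt : ∀ ω, ENNReal.ofReal ((Z ω - v) ^ (2 * p)) ≤
      ENNReal.ofReal ((v / j) ^ (2 * p)) * ((ENNReal.ofReal v)⁻¹ ^ n * ENNReal.ofReal (Z ω) ^ n +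
        ENNReal.ofReal v ^ n * (ENNReal.ofReal (Z ω))⁻¹ ^ n) := by
    intro ω
    have h := mul_sub_one_pow_le (div_nonneg (hZ ω) hv.le) p j hn0
    have e1 : (Z ω - v) ^ (2 * p) = (v / j) ^ (2 * p) * (j * (Z ω / v - 1)) ^ (2 * p) := by
      rw [← mul_pow]; congr 1; field_simp
    rw [e1, ENNReal.ofReal_mul (by positivity)]
    refine mul_le_mul_right (h.trans_eq ?_) _
    rw [ENNReal.ofReal_div_of_pos hv, ENNReal.div_eq_inv_mul, ← hn, mul_pow,
      ENNReal.mul_inv (Or.inr ENNReal.ofReal_ne_top) (Or.inl (by simpa using hv)), inv_inv, mul_pow]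
  refine (lintegral_mono hpt).trans ?_
  have hm1 : Measurable fun ω => ENNReal.ofReal (Z ω) ^ n := by fun_prop
  have hm2 : Measurable fun ω => (ENNReal.ofReal (Z ω))⁻¹ ^ n := by fun_prop
  rw [lintegral_const_mul _ (by fun_prop), lintegral_add_left (by fun_prop),
    lintegral_const_mul _ hm1, lintegral_const_mul _ hm2]
  have hvn : (ENNReal.ofReal v)⁻¹ ^ n * ENNReal.ofReal v ^ n = 1 := by
    rw [← mul_pow, ENNReal.inv_mul_cancel hv0 ENNReal.ofReal_ne_top, one_pow]
  calc _ ≤ ENNReal.ofReal ((v / j) ^ (2 * p)) *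
        ((ENNReal.ofReal v)⁻¹ ^ n * (ENNReal.ofReal C * ENNReal.ofReal v ^ n) +
          ENNReal.ofReal v ^ n * (ENNReal.ofReal C * (ENNReal.ofReal v)⁻¹ ^ n)) := by gcongr
    _ = ENNReal.ofReal ((v / j) ^ (2 * p)) *
        (ENNReal.ofReal C * ((ENNReal.ofReal v)⁻¹ ^ n * ENNReal.ofReal v ^ n) +
          ENNReal.ofReal C * ((ENNReal.ofReal v)⁻¹ ^ n * ENNReal.ofReal v ^ n)) := by ring
    _ = _ := by
        rw [hvn, mul_one, ← ENNReal.ofReal_add hC hC, ← ENNReal.ofReal_mul (by positivity)]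
        congr 1
        rw [div_pow]; ring

namespace SketchNetwork

variable {ι : Type} [Fintype ι] [DecidableEq ι] {m : ℕ}

/-- The vector is regarded as a one-column matrix indexed along the tree. Since every data vertex
occurs at a leaf, this reindexing is injective and keeps the norm. -/
lemma lintegral_embedding_le (s : ℕ) {F : ℝ → ℝ≥0∞} {c : ℝ≥0∞} (hF : LayerBound m F c)
    (hc : c ≠ ⊤) {T : SketchNetwork ι m} (hT : T.IsContractionTree) (x : (ι → Fin s) → ℝ) :
    ∫⁻ G, F (∑ o, ((T.embedding s G).mulVec x o) ^ 2) ∂(T.law s) ≤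
      c ^ T.size * F (∑ z, x z ^ 2) := by
  classical
  set e : (ι → Fin s) ↪ T.Index s := ⟨T.toIndex s, hT.toIndex_injective s⟩
  have h := T.lintegral_contractIndex_le s hF hc Unit
    (fun y _ => ∑ z, if e z = y then x z else 0)
  simp only [Finset.univ_unique, Finset.sum_singleton, sum_sq_extend, sum_comp_embedding] at h
  refine le_trans (le_of_eq (lintegral_congr fun G => ?_)) h
  congr 1
  refine Finset.sum_congr rfl fun o _ => ?_
  simp only [Matrix.mulVec, dotProduct, embedding, Matrix.of_apply, contract_eq_contractIndex]
  rfl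

/-- The embedding as a linear map between Euclidean spaces. -/
noncomputable def linearEmbedding (s : ℕ) (T : SketchNetwork ι m) (G : T.Sample s) :
    EuclideanSpace ℝ (ι → Fin s) →ₗ[ℝ] EuclideanSpace ℝ (Fin m) :=
  Matrix.toEuclideanLin (T.embedding s G)

lemma measurable_linearEmbedding (s : ℕ) (T : SketchNetwork ι m)
    (x : EuclideanSpace ℝ (ι → Fin s)) : Measurable fun G => T.linearEmbedding s G x := by
  have h : Measurable fun G => (T.embedding s G).mulVec x.ofLp := by
    refine measurable_pi_lambda _ fun o => ?_
    simp only [Matrix.mulVec, dotProduct, embedding, Matrix.of_apply]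
    exact Finset.measurable_sum _ fun z _ => (T.measurable_contract s o z).mul_const _
  exact (WithLp.measurable_toLp 2 (Fin m → ℝ)).comp h

lemma momentBound_linearEmbedding (s : ℕ) {T : SketchNetwork ι m} (hT : T.IsContractionTree)
    {p j : ℕ} (hp : 0 < p) (hj : 0 < j) (hm : 48 * Fintype.card ι * p * j ^ 2 ≤ m) :
    MomentBound (T.law s) (T.linearEmbedding s) p (2 * (Real.exp 1 / (j : ℝ) ^ 2) ^ p) := by
  intro x
  have hcard : 1 ≤ Fintype.card ι := by
    have := hT.size_le; have := T.size_pos; omega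
  set K := Fintype.card ι with hK
  have hn8 : 8 * (2 * p * j) ≤ m := by
    refine le_trans ?_ hm
    have h1 : p * j ≤ p * j ^ 2 := Nat.mul_le_mul_left p (by nlinarith)
    have h2 : 1 * (p * j ^ 2) ≤ K * (p * j ^ 2) := Nat.mul_le_mul_right _ hcard
    nlinarith
  have hm0 : 0 < m := lt_of_lt_of_le (by positivity) hn8
  have hmR : (0 : ℝ) < m := by exact_mod_cast hm0
  rcases eq_or_ne x 0 with rfl | hx
  · simp [hp.ne']
  have hv : 0 < ‖x‖ ^ 2 := by positivity
  have hnorm : ∀ G, ‖T.linearEmbedding s G x‖ ^ 2 =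
      ∑ o, ((T.embedding s G).mulVec x.ofLp o) ^ 2 := fun G => by
    rw [EuclideanSpace.real_norm_sq_eq]
    rfl
  have hxn : ‖x‖ ^ 2 = ∑ z, x.ofLp z ^ 2 := EuclideanSpace.real_norm_sq_eq x
  -- The origin of the constant 48: at most `3 K` tensors, each with exponent `4 (2 p j)² / m`, give
  -- `48 K p² j² / m ≤ p`.
  have hC : ENNReal.ofReal (Real.exp (4 * ((2 * p * j : ℕ) : ℝ) ^ 2 / m)) ^ T.size ≤
      ENNReal.ofReal (Real.exp p) := by
    rw [← ENNReal.ofReal_pow (Real.exp_pos _).le, ← Real.exp_nat_mul]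
    refine ENNReal.ofReal_le_ofReal (Real.exp_le_exp.2 ?_)
    have h1 : (T.size : ℝ) ≤ 3 * K := by exact_mod_cast hT.size_le
    have h2 : (48 : ℝ) * K * p * j ^ 2 ≤ m := by exact_mod_cast hm
    calc (T.size : ℝ) * (4 * ((2 * p * j : ℕ) : ℝ) ^ 2 / m)
        ≤ 3 * K * (4 * ((2 * p * j : ℕ) : ℝ) ^ 2 / m) := by gcongr
      _ = (p : ℝ) * (48 * K * p * j ^ 2) / m := by push_cast; ring
      _ ≤ (p : ℝ) * m / m := by gcongr
      _ = p := by field_simp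
  have h := lintegral_sub_pow_le (μ := T.law s) (Z := fun G => ‖T.linearEmbedding s G x‖ ^ 2)
    (fun G => by positivity) ((T.measurable_linearEmbedding s x).norm.pow_const 2) hv
    (Real.exp_pos p).le hp hj ?_ ?_
  · refine h.trans_eq ?_
    congr 2
    rw [div_pow, ← Real.exp_nat_mul, mul_one, pow_mul]
    ring
  · refine le_trans ?_ (mul_le_mul_left hC _)
    simp_rw [hnorm, hxn]
    exact lintegral_embedding_le s (layerBound_pow hn8) ENNReal.ofReal_ne_top hT x.ofLp
  · refine le_trans ?_ (mul_le_mul_left hC _)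
    simp_rw [hnorm, hxn]
    exact lintegral_embedding_le s (layerBound_inv_pow hn8) ENNReal.ofReal_ne_top hT x.ofLp

end SketchNetwork

/-! ### Subspace embedding and approximate matrix multiplication -/

section Random

variable {Ω E F : Type*} [MeasurableSpace Ω] [NormedAddCommGroup E] [InnerProductSpace ℝ E]
  [NormedAddCommGroup F] [InnerProductSpace ℝ F]

section Net

/-- A 1-separated subset of the ball of radius 2 has at most `5 ^ dim` points, so one of maximal
cardinality exists, and maximality makes it a net. -/
lemma exists_net (E : Type*) [NormedAddCommGroup E] [NormedSpace ℝ E] [FiniteDimensional ℝ E] :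
    ∃ s : Finset E, s.card ≤ 5 ^ Module.finrank ℝ E ∧ (∀ c ∈ s, ‖c‖ ≤ 2) ∧
      ∀ v : E, ‖v‖ ≤ 2 → ∃ c ∈ s, ‖v - c‖ ≤ 1 := by
  classical
  let P : Finset E → Prop := fun s =>
    (∀ c ∈ s, ‖c‖ ≤ 2) ∧ ∀ c ∈ s, ∀ d ∈ s, c ≠ d → 1 ≤ ‖c - d‖
  have hbound : ∀ s, P s → s.card ≤ 5 ^ Module.finrank ℝ E := fun s hs =>
    Besicovitch.card_le_of_separated s hs.1 hs.2
  let Q : ℕ → Prop := fun n => ∃ s, P s ∧ s.card = n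
  have hQ0 : Q 0 := ⟨∅, by simp [P], rfl⟩
  obtain ⟨s, hs, hcard⟩ : Q (Nat.findGreatest Q (5 ^ Module.finrank ℝ E)) :=
    Nat.findGreatest_spec (Nat.zero_le _) hQ0
  refine ⟨s, hbound s hs, hs.1, fun v hv => ?_⟩
  by_contra! hcon
  have hvs : v ∉ s := fun h => by
    have := hcon v h
    rw [sub_self, norm_zero] at this
    linarith
  have hP : P (insert v s) := by
    refine ⟨fun c hc => ?_, fun c hc d hd hcd => ?_⟩
    · rcases Finset.mem_insert.1 hc with rfl | hc'
      exacts [hv, hs.1 c hc']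
    · rcases Finset.mem_insert.1 hc with rfl | hc'
      · rcases Finset.mem_insert.1 hd with rfl | hd'
        exacts [absurd rfl hcd, (hcon d hd').le]
      · rcases Finset.mem_insert.1 hd with rfl | hd'
        · rw [norm_sub_rev]; exact (hcon c hc').le
        · exact hs.2 c hc' d hd' hcd
  have hle := Nat.le_findGreatest (P := Q) (hbound _ hP) ⟨_, hP, rfl⟩
  rw [Finset.card_insert_of_notMem hvs] at hle
  omega

lemma norm_le_of_net {G : Type*} [NormedAddCommGroup G] [NormedSpace ℝ G] {s : Finset E}
    (hs : ∀ v : E, ‖v‖ ≤ 2 → ∃ c ∈ s, ‖v - c‖ ≤ 1) (f : E →L[ℝ] G) {K : ℝ} (hK : 0 ≤ K)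
    (hf : ∀ c ∈ s, ‖f c‖ ≤ K) : ‖f‖ ≤ K := by
  have h : ‖f‖ ≤ (K + ‖f‖) / 2 := by
    refine f.opNorm_le_of_unit_norm (by positivity) fun v hv => ?_
    obtain ⟨c, hc, hvc⟩ := hs ((2 : ℝ) • v) (by rw [norm_smul, hv]; norm_num)
    have h1 : ‖f ((2 : ℝ) • v)‖ ≤ K + ‖f‖ := by
      calc ‖f ((2 : ℝ) • v)‖ = ‖f c + f ((2 : ℝ) • v - c)‖ := by rw [← map_add]; congr 2; abel
        _ ≤ ‖f c‖ + ‖f ((2 : ℝ) • v - c)‖ := norm_add_le _ _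
        _ ≤ K + ‖f‖ * 1 := add_le_add (hf c hc)
            ((f.le_opNorm _).trans (mul_le_mul_of_nonneg_left hvc (norm_nonneg _)))
        _ = _ := by rw [mul_one]
    rw [map_smul, norm_smul, Real.norm_ofNat] at h1
    linarith
  linarith

/-- The distortion is the bilinear form `B = ⟪A ·, A ·⟫ - ⟪·, ·⟫`. By polarization and the
parallelogram law, `|B c d| ≤ (‖c‖² + ‖d‖²) / 16 ≤ 1/2` on the net; `norm_le_of_net`, used once per
variable, carries this over to the norm of `B`. -/
lemma half_norm_sq_le_of_net [FiniteDimensional ℝ E] {s : Finset E} (hs2 : ∀ c ∈ s, ‖c‖ ≤ 2)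
    (hs : ∀ v : E, ‖v‖ ≤ 2 → ∃ c ∈ s, ‖v - c‖ ≤ 1) (A : E →ₗ[ℝ] F)
    (hadd : ∀ c ∈ s, ∀ d ∈ s, |‖A (c + d)‖ ^ 2 - ‖c + d‖ ^ 2| ≤ 1 / 8 * ‖c + d‖ ^ 2)
    (hsub : ∀ c ∈ s, ∀ d ∈ s, |‖A (c - d)‖ ^ 2 - ‖c - d‖ ^ 2| ≤ 1 / 8 * ‖c - d‖ ^ 2) (v : E) :
    1 / 2 * ‖v‖ ^ 2 ≤ ‖A v‖ ^ 2 := by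
  set A' : E →L[ℝ] F := LinearMap.toContinuousLinearMap A with hA'
  set B : E →L[ℝ] E →L[ℝ] ℝ := (innerSL ℝ : F →L[ℝ] F →L[ℝ] ℝ).bilinearComp A' A' -
    (innerSL ℝ : E →L[ℝ] E →L[ℝ] ℝ) with hB
  have hBapp : ∀ x y, B x y = ⟪A x, A y⟫_ℝ - ⟪x, y⟫_ℝ := fun x y => rfl
  have hBnet : ∀ c ∈ s, ∀ d ∈ s, ‖B c d‖ ≤ 1 / 2 := by
    intro c hc d hd
    have h1 := hadd c hc d hd
    have h2 := hsub c hc d hd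
    rw [map_add, norm_add_sq_real, norm_add_sq_real] at h1
    rw [map_sub, norm_sub_sq_real, norm_sub_sq_real] at h2
    have hc2 : ‖c‖ ^ 2 ≤ 4 := by nlinarith [hs2 c hc, norm_nonneg c]
    have hd2 : ‖d‖ ^ 2 ≤ 4 := by nlinarith [hs2 d hd, norm_nonneg d]
    rw [hBapp, Real.norm_eq_abs, abs_le]
    rw [abs_le] at h1 h2
    constructor <;> linarith [h1.1, h1.2, h2.1, h2.2]
  have hBn : ‖B‖ ≤ 1 / 2 := norm_le_of_net hs B (by norm_num) fun c hc =>
    norm_le_of_net hs (B c) (by norm_num) (hBnet c hc)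
  have h3 : |B v v| ≤ 1 / 2 * ‖v‖ * ‖v‖ := by
    refine (B.le_opNorm₂ v v).trans ?_
    gcongr
  rw [hBapp, real_inner_self_eq_norm_sq, real_inner_self_eq_norm_sq, abs_le] at h3
  nlinarith [h3.1]

end Net

lemma measure_lt_le_of_lintegral_pow_le {μ : Measure Ω} {Z : Ω → ℝ} (hZ : Measurable Z) {p : ℕ} {a b : ℝ} (ha : 0 < a)
    (h : ∫⁻ ω, ENNReal.ofReal (Z ω ^ p) ∂μ ≤ ENNReal.ofReal b) :
    μ {ω | a < Z ω} ≤ ENNReal.ofReal (b / a ^ p) := by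
  have hap : 0 < a ^ p := by positivity
  have hsub : {ω | a < Z ω} ⊆ {ω | ENNReal.ofReal (a ^ p) ≤ ENNReal.ofReal (Z ω ^ p)} :=
    fun ω hω => ENNReal.ofReal_le_ofReal (pow_le_pow_left₀ ha.le (le_of_lt hω) p)
  refine (measure_mono hsub).trans ((meas_ge_le_lintegral_div (by fun_prop)
    (by simpa using hap) ENNReal.ofReal_ne_top).trans ?_)
  rw [ENNReal.ofReal_div_of_pos hap]
  gcongr

variable {μ : Measure Ω} {S : Ω → E →ₗ[ℝ] F} {p : ℕ} {D : ℝ}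

lemma measure_norm_sq_deviation_le [MeasurableSpace F] [BorelSpace F]
    (hS : ∀ x, Measurable fun ω => S ω x) (h : MomentBound μ S p D) (x : E) :
    μ {ω | ¬ |‖S ω x‖ ^ 2 - ‖x‖ ^ 2| ≤ 1 / 8 * ‖x‖ ^ 2} ≤ ENNReal.ofReal (64 ^ p * D) := by
  rcases eq_or_ne x 0 with rfl | hx
  · simp
  have hv : 0 < ‖x‖ ^ 2 := by positivity
  have hm := (hS x).norm
  have h1 := measure_lt_le_of_lintegral_pow_le (μ := μ)
    (Z := fun ω => |‖S ω x‖ ^ 2 - ‖x‖ ^ 2|) (by fun_prop) (p := 2 * p)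
    (a := 1 / 8 * ‖x‖ ^ 2) (b := D * (‖x‖ ^ 2) ^ (2 * p)) (by positivity) (by
      simpa only [(even_two_mul p).pow_abs] using h x)
  simp only [not_le]
  refine h1.trans_eq ?_
  congr 1
  rw [mul_pow, pow_mul (1 / 8 : ℝ)]
  have : (64 : ℝ) ^ p * (1 / 64) ^ p = 1 := by rw [← mul_pow]; norm_num
  have h64 : ((1 : ℝ) / 8) ^ 2 = 1 / 64 := by norm_num
  rw [h64, div_eq_iff (by positivity)]
  linear_combination (-D * (‖x‖ ^ 2) ^ (2 * p)) * this

/-- Union bound over the vectors `c + d` and `c - d` with `c`, `d` in the net, whence `2 * 25 ^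
dim`. -/
lemma measure_not_half_norm_sq_le [FiniteDimensional ℝ E] [MeasurableSpace F] [BorelSpace F]
    (hS : ∀ x, Measurable fun ω => S ω x) (h : MomentBound μ S p D) :
    μ {ω | ¬ ∀ v, 1 / 2 * ‖v‖ ^ 2 ≤ ‖S ω v‖ ^ 2} ≤
      2 * 25 ^ Module.finrank ℝ E * ENNReal.ofReal (64 ^ p * D) := by
  obtain ⟨s, hcard, hs2, hs⟩ := exists_net E
  set bad : E → Set Ω := fun x => {ω | ¬ |‖S ω x‖ ^ 2 - ‖x‖ ^ 2| ≤ 1 / 8 * ‖x‖ ^ 2} with hbad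
  have hsub : {ω | ¬ ∀ v, 1 / 2 * ‖v‖ ^ 2 ≤ ‖S ω v‖ ^ 2} ⊆
      ⋃ q ∈ s ×ˢ s, (bad (q.1 + q.2) ∪ bad (q.1 - q.2)) := by
    intro ω hω
    by_contra hcon
    simp only [Set.mem_iUnion, not_exists, Set.mem_union, not_or, hbad, Set.mem_ofPred_eq,
      not_not] at hcon
    refine hω fun v => half_norm_sq_le_of_net hs2 hs (S ω) ?_ ?_ v
    · exact fun c hc d hd => (hcon (c, d) (Finset.mk_mem_product hc hd)).1
    · exact fun c hc d hd => (hcon (c, d) (Finset.mk_mem_product hc hd)).2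
  calc μ {ω | ¬ ∀ v, 1 / 2 * ‖v‖ ^ 2 ≤ ‖S ω v‖ ^ 2}
      ≤ ∑ q ∈ s ×ˢ s, μ (bad (q.1 + q.2) ∪ bad (q.1 - q.2)) :=
        (measure_mono hsub).trans (measure_biUnion_finset_le _ _)
    _ ≤ ∑ q ∈ s ×ˢ s, 2 * ENNReal.ofReal (64 ^ p * D) := by
        refine Finset.sum_le_sum fun q _ => (measure_union_le _ _).trans ?_
        rw [two_mul]
        exact add_le_add (measure_norm_sq_deviation_le hS h _) (measure_norm_sq_deviation_le hS h _)
    _ = ((s.card * s.card : ℕ) : ℝ≥0∞) * (2 * ENNReal.ofReal (64 ^ p * D)) := by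
        rw [Finset.sum_const, Finset.card_product, nsmul_eq_mul]
    _ ≤ ((25 ^ Module.finrank ℝ E : ℕ) : ℝ≥0∞) * (2 * ENNReal.ofReal (64 ^ p * D)) := by
        gcongr
        calc s.card * s.card ≤ 5 ^ Module.finrank ℝ E * 5 ^ Module.finrank ℝ E :=
              Nat.mul_le_mul hcard hcard
          _ = _ := by rw [← mul_pow]; norm_num
    _ = _ := by push_cast; ring

/-- Polarization: since `‖u + b‖ = ‖u - b‖`, the inner product is a quarter of the difference of two
norm deviations. The constants of the power-mean inequality cancel exactly, so `D` is kept. -/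
lemma lintegral_inner_pow_le [MeasurableSpace F] [BorelSpace F]
    (hS : ∀ x, Measurable fun ω => S ω x) (h : MomentBound μ S p D) (hp : 0 < p) (hD : 0 ≤ D)
    {u b : E} (hu : ‖u‖ = 1) (hb : ‖b‖ = 1) (hub : ⟪u, b⟫_ℝ = 0) :
    ∫⁻ ω, ENNReal.ofReal ((⟪S ω u, S ω b⟫_ℝ ^ 2) ^ p) ∂μ ≤ ENNReal.ofReal D := by
  have hadd : ‖u + b‖ ^ 2 = 2 := by rw [norm_add_sq_real, hu, hb, hub]; norm_num
  have hsub : ‖u - b‖ ^ 2 = 2 := by rw [norm_sub_sq_real, hu, hb, hub]; norm_num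
  have hpt : ∀ ω, ENNReal.ofReal ((⟪S ω u, S ω b⟫_ℝ ^ 2) ^ p) ≤
      ENNReal.ofReal ((1 / 4) ^ (2 * p) * 2 ^ (2 * p - 1)) *
        (ENNReal.ofReal ((‖S ω (u + b)‖ ^ 2 - ‖u + b‖ ^ 2) ^ (2 * p)) +
          ENNReal.ofReal ((‖S ω (u - b)‖ ^ 2 - ‖u - b‖ ^ 2) ^ (2 * p))) := by
    intro ω
    have hev := even_two_mul p
    rw [← ENNReal.ofReal_add (hev.pow_nonneg _) (hev.pow_nonneg _),
      ← ENNReal.ofReal_mul (by positivity)]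
    refine ENNReal.ofReal_le_ofReal ?_
    set a := ‖S ω (u + b)‖ ^ 2 - ‖u + b‖ ^ 2 with ha
    set c := ‖S ω (u - b)‖ ^ 2 - ‖u - b‖ ^ 2 with hc
    have h1 : ⟪S ω u, S ω b⟫_ℝ = 1 / 4 * (a + -c) := by
      rw [ha, hc, hadd, hsub, map_add, map_sub, norm_add_sq_real, norm_sub_sq_real]
      ring
    rw [← pow_mul, h1, mul_pow, mul_assoc]
    refine mul_le_mul_of_nonneg_left ?_ (by positivity)
    refine (hev.add_pow_le).trans_eq ?_
    rw [hev.neg_pow]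
  refine (lintegral_mono hpt).trans ?_
  have hm1 := (hS (u + b)).norm
  rw [lintegral_const_mul' _ _ ENNReal.ofReal_ne_top, lintegral_add_left (by fun_prop)]
  refine (mul_le_mul_right (add_le_add (h _) (h _)) _).trans_eq ?_
  rw [hadd, hsub, ← ENNReal.ofReal_add (by positivity) (by positivity),
    ← ENNReal.ofReal_mul (by positivity)]
  congr 1
  obtain ⟨n, rfl⟩ : ∃ n, p = n + 1 := ⟨p - 1, by omega⟩
  have h2 : 2 * (n + 1) - 1 = 2 * n + 1 := by omega
  have h4 : (1 / 4 : ℝ) ^ (2 * (n + 1)) * 2 ^ (2 * n + 1) * (2 * 2 ^ (2 * (n + 1))) = 1 := by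
    calc (1 / 4 : ℝ) ^ (2 * (n + 1)) * 2 ^ (2 * n + 1) * (2 * 2 ^ (2 * (n + 1)))
        = (1 / 4 * 2 * 2) ^ (2 * (n + 1)) := by rw [mul_pow, mul_pow]; ring
      _ = 1 := by norm_num
  rw [h2]
  linear_combination D * h4

/-- Jensen's inequality with weights proportional to `‖b t‖²` bounds the `p`-th moment of the double
sum by that of a single normalized pair, and Markov's inequality concludes. The number of vectors `b
t` does not enter. -/
lemma measure_sum_inner_sq_le [MeasurableSpace F] [BorelSpace F] [SecondCountableTopology F]
    (hS : ∀ x, Measurable fun ω => S ω x) (h : MomentBound μ S p D) (hp : 0 < p) (hD : 0 ≤ D)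
    {ρ τ : Type*} [Fintype ρ] [Fintype τ] (u : ρ → E) (b : τ → E) (hu : ∀ r, ‖u r‖ = 1)
    (hub : ∀ r t, ⟪u r, b t⟫_ℝ = 0) {a : ℝ} (ha : 0 < a) :
    μ {ω | ¬ ∑ r, ∑ t, ⟪S ω (u r), S ω (b t)⟫_ℝ ^ 2 ≤ a * ∑ t, ‖b t‖ ^ 2} ≤
      ENNReal.ofReal ((Fintype.card ρ / a) ^ p * D) := by
  simp only [not_le]
  set W := ∑ t, ‖b t‖ ^ 2 with hW
  have hW0 : 0 ≤ W := Finset.sum_nonneg fun t _ => by positivity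
  rcases hW0.eq_or_lt with h0 | hWpos
  · have hb : ∀ t, b t = 0 := fun t => by
      have := (Finset.sum_eq_zero_iff_of_nonneg fun t _ => sq_nonneg ‖b t‖).1 (hW ▸ h0.symm) t
        (Finset.mem_univ t)
      simpa using this
    simp [hb, ← h0]
  rcases isEmpty_or_nonempty ρ with hρ | hρ
  · have : 0 < a * W := by positivity
    simp [not_lt.2 this.le]
  have hd : (0 : ℝ) < Fintype.card ρ := by exact_mod_cast Fintype.card_pos
  set d : ℝ := (Fintype.card ρ : ℝ) with hdd
  have hm : ∀ x y, Measurable fun ω => ⟪S ω x, S ω y⟫_ℝ := fun x y => (hS x).inner (hS y)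
  have hmoment : ∫⁻ ω, ENNReal.ofReal ((∑ r, ∑ t, ⟪S ω (u r), S ω (b t)⟫_ℝ ^ 2) ^ p) ∂μ ≤
      ENNReal.ofReal ((d * W) ^ p * D) := by
    set w : ρ × τ → ℝ := fun q => ‖b q.2‖ ^ 2 / (d * W) with hw
    have hw0 : ∀ q, 0 ≤ w q := fun q => by positivity
    have hw1 : ∑ q, w q = 1 := by
      rw [← Finset.sum_div, Fintype.sum_prod_type]
      simp only [Finset.sum_const, ← hW, Finset.card_univ, nsmul_eq_mul]
      exact div_self (by positivity)
    set z : ρ × τ → Ω → ℝ := fun q ω =>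
      ⟪S ω (u q.1), S ω ((‖b q.2‖)⁻¹ • b q.2)⟫_ℝ ^ 2 with hz
    have hpt : ∀ ω, ENNReal.ofReal ((∑ r, ∑ t, ⟪S ω (u r), S ω (b t)⟫_ℝ ^ 2) ^ p) ≤
        ENNReal.ofReal ((d * W) ^ p) * ∑ q, ENNReal.ofReal (w q) *
          ENNReal.ofReal (z q ω ^ p) := by
      intro ω
      have h1 : ∑ r, ∑ t, ⟪S ω (u r), S ω (b t)⟫_ℝ ^ 2 = d * W * ∑ q, w q * z q ω := by
        rw [← Fintype.sum_prod_type', Finset.mul_sum]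
        refine Finset.sum_congr rfl fun q _ => ?_
        rcases eq_or_ne (b q.2) 0 with hb | hb
        · simp [hw, hb]
        · have : ‖b q.2‖ ≠ 0 := norm_ne_zero_iff.2 hb
          simp only [hw, hz, map_smul, inner_smul_right]
          field_simp
      have h2 := (convexOn_pow p).map_sum_le (t := Finset.univ) (w := w) (p := fun q => z q ω)
        (fun q _ => hw0 q) hw1 (fun q _ => Set.mem_Ici.2 (sq_nonneg _))
      simp only [smul_eq_mul] at h2
      have h3 : ∑ q, ENNReal.ofReal (w q) * ENNReal.ofReal (z q ω ^ p) =
          ENNReal.ofReal (∑ q, w q * z q ω ^ p) := by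
        rw [ENNReal.ofReal_sum_of_nonneg fun q _ =>
          mul_nonneg (hw0 q) (pow_nonneg (sq_nonneg _) p)]
        exact Finset.sum_congr rfl fun q _ => (ENNReal.ofReal_mul (hw0 q)).symm
      rw [h1, h3, ← ENNReal.ofReal_mul (by positivity), mul_pow]
      exact ENNReal.ofReal_le_ofReal (mul_le_mul_of_nonneg_left h2 (by positivity))
    have hzm : ∀ q, Measurable (z q) := fun q => (hm _ _).pow_const 2
    refine (lintegral_mono hpt).trans ?_
    rw [lintegral_const_mul' _ _ ENNReal.ofReal_ne_top, lintegral_finsetSum _ fun q _ => by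
      have := hzm q
      fun_prop, ENNReal.ofReal_mul (by positivity)]
    refine mul_le_mul_right ?_ _
    have hterm : ∀ q, ∫⁻ ω, ENNReal.ofReal (w q) * ENNReal.ofReal (z q ω ^ p) ∂μ ≤
        ENNReal.ofReal (w q) * ENNReal.ofReal D := by
      intro q
      rw [lintegral_const_mul' _ _ ENNReal.ofReal_ne_top]
      rcases eq_or_ne (b q.2) 0 with hb | hb
      · simp [hw, hb]
      · refine mul_le_mul_right (lintegral_inner_pow_le hS h hp hD (hu _) ?_ ?_) _
        · rw [norm_smul, norm_inv, norm_norm, inv_mul_cancel₀ (norm_ne_zero_iff.2 hb)]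
        · rw [inner_smul_right, hub, mul_zero]
    refine (Finset.sum_le_sum fun q _ => hterm q).trans_eq ?_
    rw [← Finset.sum_mul, ← ENNReal.ofReal_sum_of_nonneg fun q _ => hw0 q, hw1,
      ENNReal.ofReal_one, one_mul]
  refine (measure_lt_le_of_lintegral_pow_le (a := a * W)
    (Finset.measurable_sum _ fun r _ => Finset.measurable_sum _ fun t _ => (hm _ _).pow_const 2)
    (by positivity) hmoment).trans_eq ?_
  congr 1
  rw [mul_pow, mul_pow, div_pow]
  field_simp

end Random

/-! ### Least squares -/

section LeastSquares

variable {W E F : Type*} [NormedAddCommGroup W] [InnerProductSpace ℝ W] [FiniteDimensional ℝ W]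
  [NormedAddCommGroup E] [InnerProductSpace ℝ E] [NormedAddCommGroup F] [InnerProductSpace ℝ F]
  {τ : Type*} [Fintype τ]

lemma exists_forall_sum_norm_sq_le (A : W →ₗ[ℝ] E) (y : τ → E) :
    ∃ B : τ → W, ∀ B' : τ → W, ∑ t, ‖A (B t) - y t‖ ^ 2 ≤ ∑ t, ‖A (B' t) - y t‖ ^ 2 := by
  have h : ∀ t, ∃ w, ∀ w', ‖A w - y t‖ ^ 2 ≤ ‖A w' - y t‖ ^ 2 := by
    intro t
    obtain ⟨w, hw⟩ := (LinearMap.range A).starProjection_apply_mem (y t)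
    refine ⟨w, fun w' => ?_⟩
    rw [hw, norm_sub_rev, norm_sub_rev (A w'), Submodule.starProjection_minimal]
    refine pow_le_pow_left₀ (Real.iInf_nonneg fun _ => norm_nonneg _) ?_ 2
    exact ciInf_le ⟨0, by rintro _ ⟨z, rfl⟩; exact norm_nonneg _⟩
      (⟨A w', LinearMap.mem_range_self A w'⟩ : LinearMap.range A)
  choose B hB using h
  exact ⟨B, fun B' => Finset.sum_le_sum fun t _ => hB t (B' t)⟩

/-- A solution of the sketched least squares problem is accurate if the sketch does not shrink the
column space and nearly preserves its orthogonality to the residual. -/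
lemma sum_norm_sq_le_of_sketch (A : W →ₗ[ℝ] E) (y : τ → E) (S : E →ₗ[ℝ] F) {ε : ℝ}
    {ρ : Type*} [Fintype ρ] (u : OrthonormalBasis ρ ℝ (LinearMap.range A))
    (h1 : ∀ v : LinearMap.range A, 1 / 2 * ‖v‖ ^ 2 ≤ ‖S v‖ ^ 2)
    (h2 : ∑ r, ∑ t, ⟪S (u r), S (y t - (LinearMap.range A).starProjection (y t))⟫_ℝ ^ 2 ≤
      ε / 16 * ∑ t, ‖y t - (LinearMap.range A).starProjection (y t)‖ ^ 2) (hε : 0 ≤ ε)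
    {B : τ → W} (hB : ∀ B' : τ → W,
      ∑ t, ‖S (A (B t)) - S (y t)‖ ^ 2 ≤ ∑ t, ‖S (A (B' t)) - S (y t)‖ ^ 2) (B' : τ → W) :
    ∑ t, ‖A (B t) - y t‖ ^ 2 ≤ (1 + ε) * ∑ t, ‖A (B' t) - y t‖ ^ 2 := by
  set b : τ → E := fun t => y t - (LinearMap.range A).starProjection (y t) with hb
  have horth : ∀ t, ∀ v ∈ LinearMap.range A, ⟪v, b t⟫_ℝ = 0 := fun t v hv =>
    (LinearMap.range A).mem_orthogonal _ |>.1 ((LinearMap.range A).sub_starProjection_mem_orthogonal (y t)) v hv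
  have hpy : ∀ (w : W) t, ‖A w - y t‖ ^ 2 = ‖A w - (LinearMap.range A).starProjection (y t)‖ ^ 2 + ‖b t‖ ^ 2 := by
    intro w t
    have e : A w - y t = (A w - (LinearMap.range A).starProjection (y t)) - b t := by simp only [hb]; abel
    rw [e, norm_sub_sq_real, horth t _ ((LinearMap.range A).sub_mem (LinearMap.mem_range_self A w)
      ((LinearMap.range A).starProjection_apply_mem _))]
    ring
  choose Bs hBs using fun t => (LinearMap.range A).starProjection_apply_mem (y t)
  set z : τ → LinearMap.range A := fun t => ⟨A (B t) - (LinearMap.range A).starProjection (y t),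
    (LinearMap.range A).sub_mem (LinearMap.mem_range_self A _) ((LinearMap.range A).starProjection_apply_mem _)⟩ with hz
  -- Comparison with an unsketched optimum `Bs`: the terms `‖S (b t)‖²` cancel, leaving `∑ ‖S z‖² ≤
  -- 2 ∑ ⟪S z, S b⟫`.
  have hcmp := hB Bs
  have e1 : ∀ t, S (A (B t)) - S (y t) = S (z t) - S (b t) := fun t => by
    rw [← map_sub, ← map_sub]; congr 1; simp only [hz, hb]; abel
  have e2 : ∀ t, S (A (Bs t)) - S (y t) = - S (b t) := fun t => by
    rw [← map_sub, ← map_neg, hBs]; congr 1; simp only [hb]; abel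
  simp_rw [e1, e2, norm_neg, norm_sub_sq_real, Finset.sum_add_distrib,
    Finset.sum_sub_distrib, ← Finset.mul_sum] at hcmp
  set X := ∑ r, ∑ t, ⟪S (u r), S (b t)⟫_ℝ ^ 2 with hX
  have hz1 : 1 / 2 * ∑ t, ‖z t‖ ^ 2 ≤ ∑ t, ‖S (z t)‖ ^ 2 := by
    rw [Finset.mul_sum]
    exact Finset.sum_le_sum fun t _ => h1 (z t)
  -- Weighted AM-GM in the coordinates of `z t`. Doubled, the term `1/8` takes half of the lower
  -- bound `1/2 ∑ ‖z‖²`, so that `∑ ‖z‖² ≤ 16 X`; hence the `ε / 16` in the hypothesis.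
  have hin : ∀ t, ⟪S (z t), S (b t)⟫_ℝ ≤
      1 / 8 * ‖z t‖ ^ 2 + 2 * ∑ r, ⟪S (u r), S (b t)⟫_ℝ ^ 2 := by
    intro t
    have e3 : S (z t) = ∑ r, ⟪u r, z t⟫_ℝ • S (u r) := by
      conv_lhs => rw [← u.sum_repr' (z t)]
      simp [map_sum]
    rw [e3, sum_inner, ← u.sum_sq_inner_right (z t), Finset.mul_sum, Finset.mul_sum,
      ← Finset.sum_add_distrib]
    refine Finset.sum_le_sum fun r _ => ?_
    rw [real_inner_smul_left]
    nlinarith [sq_nonneg (⟪u r, z t⟫_ℝ - 4 * ⟪S (u r), S (b t)⟫_ℝ)]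
  have hsum : ∑ t, ⟪S (z t), S (b t)⟫_ℝ ≤ 1 / 8 * ∑ t, ‖z t‖ ^ 2 + 2 * X := by
    refine (Finset.sum_le_sum fun t _ => hin t).trans_eq ?_
    rw [Finset.sum_add_distrib, ← Finset.mul_sum, ← Finset.mul_sum, hX, Finset.sum_comm]
  have h2' : X ≤ ε / 16 * ∑ t, ‖b t‖ ^ 2 := h2
  have hzb : ∑ t, ‖z t‖ ^ 2 ≤ ε * ∑ t, ‖b t‖ ^ 2 := by linarith
  have hobj : ∑ t, ‖A (B t) - y t‖ ^ 2 = ∑ t, ‖z t‖ ^ 2 + ∑ t, ‖b t‖ ^ 2 := by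
    rw [← Finset.sum_add_distrib]
    exact Finset.sum_congr rfl fun t _ => hpy (B t) t
  have hb' : ∑ t, ‖b t‖ ^ 2 ≤ ∑ t, ‖A (B' t) - y t‖ ^ 2 :=
    Finset.sum_le_sum fun t _ => by
      rw [hpy]
      exact le_add_of_nonneg_left (sq_nonneg _)
  calc _ ≤ (1 + ε) * ∑ t, ‖b t‖ ^ 2 := by rw [hobj]; linarith
    _ ≤ _ := by gcongr

end LeastSquares

/-! ### The matrix problem and its failure probability -/

lemma lsqObj_eq_sum_norm_sq {κ : Type*} [Fintype κ] {s R : ℕ} (L : Matrix κ (Fin R) ℝ)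
    (Y : Matrix κ (Fin s) ℝ) (B : Matrix (Fin s) (Fin R) ℝ) :
    lsqObj L Y B =
      ∑ t, ‖Matrix.toEuclideanLin L (WithLp.toLp 2 (B t)) - WithLp.toLp 2 (Y.col t)‖ ^ 2 := by
  classical
  simp_rw [EuclideanSpace.real_norm_sq_eq, lsqObj, frobSq]
  rw [Finset.sum_comm]
  rfl

lemma exists_isLsqSolution {κ : Type*} [Fintype κ] {s R : ℕ} (L : Matrix κ (Fin R) ℝ)
    (Y : Matrix κ (Fin s) ℝ) : ∃ B, IsLsqSolution L Y B := by
  obtain ⟨B, hB⟩ := exists_forall_sum_norm_sq_le (Matrix.toEuclideanLin L)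
    fun t => WithLp.toLp 2 (Y.col t)
  refine ⟨Matrix.of fun t => (B t).ofLp, fun B' => ?_⟩
  rw [lsqObj_eq_sum_norm_sq, lsqObj_eq_sum_norm_sq]
  exact hB fun t => WithLp.toLp 2 (B' t)

lemma isLsqAccurate_of_sketch {κ : Type*} [Fintype κ] [DecidableEq κ] {s R m : ℕ}
    {L : Matrix κ (Fin R) ℝ}
    {Y : Matrix κ (Fin s) ℝ} {S : Matrix (Fin m) κ ℝ} {ε : ℝ} (hε : 0 ≤ ε) {ρ : Type*} [Fintype ρ]
    (u : OrthonormalBasis ρ ℝ (LinearMap.range (Matrix.toEuclideanLin L)))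
    (h1 : ∀ v : LinearMap.range (Matrix.toEuclideanLin L),
      1 / 2 * ‖v‖ ^ 2 ≤ ‖Matrix.toEuclideanLin S v‖ ^ 2)
    (h2 : ∑ r, ∑ t, ⟪Matrix.toEuclideanLin S (u r), Matrix.toEuclideanLin S
        (WithLp.toLp 2 (Y.col t) - (LinearMap.range (Matrix.toEuclideanLin L)).starProjection
          (WithLp.toLp 2 (Y.col t)))⟫_ℝ ^ 2 ≤
      ε / 16 * ∑ t, ‖WithLp.toLp 2 (Y.col t) -
        (LinearMap.range (Matrix.toEuclideanLin L)).starProjection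
          (WithLp.toLp 2 (Y.col t))‖ ^ 2)
    {B : Matrix (Fin s) (Fin R) ℝ} (hB : IsLsqSolution (S * L) (S * Y) B) :
    IsLsqAccurate ε L Y B := by
  have hS : ∀ B' : Matrix (Fin s) (Fin R) ℝ, lsqObj (S * L) (S * Y) B' =
      ∑ t, ‖Matrix.toEuclideanLin S (Matrix.toEuclideanLin L (WithLp.toLp 2 (B' t))) -
        Matrix.toEuclideanLin S (WithLp.toLp 2 (Y.col t))‖ ^ 2 := by
    intro B'
    rw [lsqObj_eq_sum_norm_sq]
    refine Finset.sum_congr rfl fun t _ => ?_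
    congr 3
    exact congrArg (WithLp.toLp 2) (Matrix.mulVec_mulVec (B' t) S L).symm
  intro B'
  rw [lsqObj_eq_sum_norm_sq, lsqObj_eq_sum_norm_sq]
  refine sum_norm_sq_le_of_sketch (Matrix.toEuclideanLin L) (fun t => WithLp.toLp 2 (Y.col t))
    (Matrix.toEuclideanLin S) u h1 h2 hε (B := fun t => WithLp.toLp 2 (B t)) (fun B'' => ?_)
    (fun t => WithLp.toLp 2 (B' t))
  have := hB (Matrix.of fun t => (B'' t).ofLp)
  rw [hS, hS] at this
  exact this

/-- The failure event of the sketched least squares problem. -/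
def sketchFailure {κ : Type*} [Fintype κ] {s R m : ℕ} {Ω : Type*} (S : Ω → Matrix (Fin m) κ ℝ)
    (ε : ℝ) (L : Matrix κ (Fin R) ℝ) (Y : Matrix κ (Fin s) ℝ) : Set Ω :=
  {ω | ¬ ((∃ B, IsLsqSolution (S ω * L) (S ω * Y) B) ∧
    ∀ B, IsLsqSolution (S ω * L) (S ω * Y) B → IsLsqAccurate ε L Y B)}

lemma measure_sketchFailure_le {ι : Type} [Fintype ι] [DecidableEq ι] {m s R : ℕ}
    {T : SketchNetwork ι m} (hT : T.IsContractionTree) (L : Matrix (ι → Fin s) (Fin R) ℝ)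
    (Y : Matrix (ι → Fin s) (Fin s) ℝ) {ε : ℝ} (hε : 0 < ε) {p q j k : ℕ} (hp : 0 < p) (hj : 0 < j)
    (hq : 0 < q) (hk : 0 < k) (hpj : 48 * Fintype.card ι * p * j ^ 2 ≤ m)
    (hqk : 48 * Fintype.card ι * q * k ^ 2 ≤ m) :
    T.law s (sketchFailure (T.embedding s) ε L Y) ≤
      ENNReal.ofReal (4 * 25 ^ R * (64 * Real.exp 1 / (j : ℝ) ^ 2) ^ p) +
        ENNReal.ofReal (2 * (16 * R * Real.exp 1 / (ε * (k : ℝ) ^ 2)) ^ q) := by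
  set V := LinearMap.range (Matrix.toEuclideanLin L) with hV
  have hd : Module.finrank ℝ V ≤ R := by
    have := LinearMap.finrank_range_le (Matrix.toEuclideanLin L)
    rwa [finrank_euclideanSpace, Fintype.card_fin] at this
  have hm1 := T.measurable_linearEmbedding s
  set u := stdOrthonormalBasis ℝ V with hu
  set b : Fin s → EuclideanSpace ℝ (ι → Fin s) := fun t =>
    WithLp.toLp 2 (Y.col t) - V.starProjection (WithLp.toLp 2 (Y.col t)) with hb
  set bad₁ : Set (T.Sample s) :=
    {G | ¬ ∀ v : V, 1 / 2 * ‖v‖ ^ 2 ≤ ‖(T.linearEmbedding s G ∘ₗ V.subtype) v‖ ^ 2} with hbad₁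
  set bad₂ : Set (T.Sample s) :=
    {G | ¬ ∑ r, ∑ t, ⟪T.linearEmbedding s G (u r), T.linearEmbedding s G (b t)⟫_ℝ ^ 2 ≤
      ε / 16 * ∑ t, ‖b t‖ ^ 2} with hbad₂
  have hsub : sketchFailure (T.embedding s) ε L Y ⊆ bad₁ ∪ bad₂ := by
    intro G hG
    by_contra hcon
    simp only [hbad₁, hbad₂, Set.mem_union, Set.mem_ofPred_eq, not_or, not_not] at hcon
    exact hG ⟨exists_isLsqSolution _ _, fun B hB =>
      isLsqAccurate_of_sketch hε.le u hcon.1 hcon.2 hB⟩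
  refine (measure_mono hsub).trans ((measure_union_le _ _).trans (add_le_add ?_ ?_))
  · have hmom := SketchNetwork.momentBound_linearEmbedding s hT hp hj hpj
    have h := measure_not_half_norm_sq_le (μ := T.law s)
      (S := fun G => T.linearEmbedding s G ∘ₗ V.subtype) (fun v => hm1 v) (fun v => hmom v)
    refine h.trans ?_
    calc (2 : ℝ≥0∞) * 25 ^ Module.finrank ℝ V * _
        ≤ 2 * 25 ^ R * ENNReal.ofReal (64 ^ p * (2 * (Real.exp 1 / (j : ℝ) ^ 2) ^ p)) := by
          gcongr
          norm_num
      _ = _ := by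
          have h25 : (2 : ℝ≥0∞) * 25 ^ R = ENNReal.ofReal (2 * 25 ^ R) := by
            rw [ENNReal.ofReal_mul (by norm_num), ENNReal.ofReal_pow (by norm_num)]
            norm_num
          rw [h25, ← ENNReal.ofReal_mul (by positivity)]
          congr 1
          rw [mul_div_assoc, mul_pow]
          ring
  · have hmom := SketchNetwork.momentBound_linearEmbedding s hT hq hk hqk
    refine (measure_sum_inner_sq_le hm1 hmom hq (by positivity) (fun r => (u r : _)) b ?_ ?_
      (by positivity : (0 : ℝ) < ε / 16)).trans (ENNReal.ofReal_le_ofReal ?_)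
    · exact fun r => u.norm_eq_one r
    · exact fun r t => V.mem_orthogonal _ |>.1 (V.sub_starProjection_mem_orthogonal _) _ (u r).2
    · have hkR : (0 : ℝ) < k := by exact_mod_cast hk
      rw [Fintype.card_fin, mul_left_comm, ← mul_pow]
      have hdR : (Module.finrank ℝ V : ℝ) ≤ R := by exact_mod_cast hd
      have : (Module.finrank ℝ V : ℝ) / (ε / 16) * (Real.exp 1 / (k : ℝ) ^ 2) ≤
          16 * R * Real.exp 1 / (ε * (k : ℝ) ^ 2) := by
        calc (Module.finrank ℝ V : ℝ) / (ε / 16) * (Real.exp 1 / (k : ℝ) ^ 2)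
            ≤ R / (ε / 16) * (Real.exp 1 / (k : ℝ) ^ 2) := by gcongr
          _ = _ := by field_simp
      gcongr

lemma isLsqAccurate_of_isEmpty {κ : Type*} [Fintype κ] {s : ℕ} {ε : ℝ} (hε : 0 ≤ ε)
    (L : Matrix κ (Fin 0) ℝ) (Y : Matrix κ (Fin s) ℝ) (B : Matrix (Fin s) (Fin 0) ℝ) :
    IsLsqAccurate ε L Y B := by
  intro B'
  have h0 : 0 ≤ lsqObj L Y B :=
    Finset.sum_nonneg fun x _ => Finset.sum_nonneg fun y _ => sq_nonneg _
  have : B' = B := Subsingleton.elim _ _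
  rw [this]
  nlinarith

/-! ### Numerical constants and the choice of the moment orders -/

lemma exp_one_sq_lt : Real.exp 1 ^ 2 < 7.3891 := by
  have := Real.exp_one_lt_d9
  have h0 := Real.exp_pos 1
  nlinarith

lemma eight_le_exp_three : (8 : ℝ) ≤ Real.exp 3 := by
  have h := Real.exp_one_gt_d9
  have : Real.exp 3 = Real.exp 1 ^ 3 := by rw [← Real.exp_nat_mul]; norm_num
  rw [this]
  calc (8 : ℝ) = 2 ^ 3 := by norm_num
    _ ≤ _ := pow_le_pow_left₀ (by norm_num) (by linarith) 3

lemma twentyFive_le_exp_four : (25 : ℝ) ≤ Real.exp 4 := by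
  have h := Real.exp_one_gt_d9
  have : Real.exp 4 = Real.exp 1 ^ 4 := by rw [← Real.exp_nat_mul]; norm_num
  rw [this]
  calc (25 : ℝ) ≤ 2.5 ^ 4 := by norm_num
    _ ≤ _ := pow_le_pow_left₀ (by norm_num) (by linarith) 4

/-- The value 22 makes the base at most `1 / e`, since `64 e² < 22²`. The order `3 + 4 R + l` then
pays for the prefactor through `8 ≤ e³` and `25 ≤ e⁴`. -/
lemma subspace_failure_le {R p : ℕ} {l : ℝ} (hp : 3 + 4 * R + l ≤ p) :
    4 * 25 ^ R * (64 * Real.exp 1 / ((22 : ℕ) : ℝ) ^ 2) ^ p ≤ Real.exp (-l) / 2 := by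
  have h1 : 64 * Real.exp 1 / ((22 : ℕ) : ℝ) ^ 2 ≤ Real.exp (-1) := by
    rw [Real.exp_neg, div_le_iff₀ (by norm_num), inv_mul_eq_div, le_div_iff₀ (Real.exp_pos 1)]
    have := exp_one_sq_lt
    push_cast
    nlinarith
  have h2 : (64 * Real.exp 1 / ((22 : ℕ) : ℝ) ^ 2) ^ p ≤ Real.exp (-(3 + 4 * R + l)) := by
    refine (pow_le_pow_left₀ (by positivity) h1 p).trans ?_
    rw [← Real.exp_nat_mul]
    exact Real.exp_le_exp.2 (by linarith)
  have h3 : (25 : ℝ) ^ R ≤ Real.exp (4 * R) := by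
    rw [mul_comm, Real.exp_nat_mul]
    exact pow_le_pow_left₀ (by norm_num) twentyFive_le_exp_four R
  have h4 : 4 ≤ Real.exp 3 / 2 := by linarith [eight_le_exp_three]
  calc _ ≤ Real.exp 3 / 2 * Real.exp (4 * R) * Real.exp (-(3 + 4 * R + l)) := by gcongr
    _ = Real.exp (3 + 4 * R + -(3 + 4 * R + l)) / 2 := by
      rw [Real.exp_add, Real.exp_add]; ring
    _ = _ := by congr 2; ring

/-- Here `11² = 121` exceeds `16 e²`, so the base is again at most `1 / e`. No net is involved, so
the order need not grow with `R`. -/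
lemma product_failure_le {R q k : ℕ} {ε l : ℝ} (hε : 0 < ε) (hR : 0 < R)
    (hk : 11 * √(R / ε) ≤ k) (hq : 3 + l ≤ q) :
    2 * (16 * R * Real.exp 1 / (ε * (k : ℝ) ^ 2)) ^ q ≤ Real.exp (-l) / 2 := by
  have hRR : (0 : ℝ) < R := by exact_mod_cast hR
  have hk2 : 121 * (R / ε) ≤ (k : ℝ) ^ 2 := by
    have := pow_le_pow_left₀ (by positivity) hk 2
    rw [mul_pow, Real.sq_sqrt (by positivity)] at this
    linarith
  have hk3 : 121 * R ≤ ε * (k : ℝ) ^ 2 := by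
    have := mul_le_mul_of_nonneg_left hk2 hε.le
    have e : ε * (121 * (R / ε)) = 121 * R := by field_simp
    linarith
  have h1 : 16 * R * Real.exp 1 / (ε * (k : ℝ) ^ 2) ≤ Real.exp (-1) := by
    rw [Real.exp_neg, div_le_iff₀ (by linarith), inv_mul_eq_div, le_div_iff₀ (Real.exp_pos 1)]
    have := exp_one_sq_lt
    nlinarith
  have h2 : (16 * R * Real.exp 1 / (ε * (k : ℝ) ^ 2)) ^ q ≤ Real.exp (-(3 + l)) := by
    refine (pow_le_pow_left₀ (by positivity) h1 q).trans ?_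
    rw [← Real.exp_nat_mul]
    exact Real.exp_le_exp.2 (by linarith)
  calc _ ≤ Real.exp 3 / 2 * Real.exp (-(3 + l)) := by
        gcongr
        linarith [eight_le_exp_three]
    _ = Real.exp (3 + -(3 + l)) / 2 := by rw [Real.exp_add]; ring
    _ = _ := by congr 2; ring

lemma measure_sketchFailure_le_of_size {ι : Type} [Fintype ι] [DecidableEq ι] {N m s R : ℕ}
    (hN : Fintype.card ι ≤ N) {T : SketchNetwork ι m} (hT : T.IsContractionTree)
    (L : Matrix (ι → Fin s) (Fin R) ℝ) (Y : Matrix (ι → Fin s) (Fin s) ℝ) {ε l l₀ : ℝ}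
    (hR : 0 < R) (hε : 0 < ε) (hε1 : ε ≤ 1) (hl₀ : 0 < l₀) (hl : l₀ ≤ l)
    (hm : 23232 * (8 / l₀ + 1) * (N * R * l / ε ^ 2) ≤ m) :
    T.law s (sketchFailure (T.embedding s) ε L Y) ≤ ENNReal.ofReal (Real.exp (-l)) := by
  have hR1 : (1 : ℝ) ≤ R := by exact_mod_cast hR
  have hlpos : 0 < l := hl₀.trans_le hl
  have hll : 8 ≤ 8 / l₀ * l := by
    rw [div_mul_eq_mul_div, le_div_iff₀ hl₀]; linarith
  have hNR : (Fintype.card ι : ℝ) ≤ N := by exact_mod_cast hN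
  have hε2 : ε ^ 2 ≤ ε := by nlinarith
  have hε3 : ε ^ 2 ≤ 1 := hε2.trans hε1
  set p := ⌈3 + 4 * R + l⌉₊ with hp
  set q := ⌈3 + l⌉₊ with hq
  set k := ⌈11 * √(R / ε)⌉₊ with hk
  have hsq1 : 1 ≤ √(R / ε) := by
    rw [Real.one_le_sqrt, one_le_div hε]; linarith
  -- Rounding up gives `p ≤ 4 + 4 R + l ≤ 8 R + R l`, and `8 ≤ (8 / l₀) l` absorbs the additive
  -- part; only here and for `q` does `l₀` matter.
  have hp1 : (p : ℝ) ≤ (8 / l₀ + 1) * (R * l) := by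
    have := (Nat.ceil_lt_add_one (by positivity : 0 ≤ 3 + 4 * (R : ℝ) + l)).le
    rw [← hp] at this
    nlinarith
  have hq1 : (q : ℝ) ≤ (8 / l₀ + 1) * l := by
    have := (Nat.ceil_lt_add_one (by positivity : 0 ≤ 3 + l)).le
    rw [← hq] at this
    linarith
  have hk1 : (k : ℝ) ^ 2 ≤ 144 * (R / ε) := by
    have h1 := (Nat.ceil_lt_add_one (by positivity : 0 ≤ 11 * √((R : ℝ) / ε))).le
    rw [← hk] at h1
    have h2 := pow_le_pow_left₀ (Nat.cast_nonneg k) (h1.trans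
      (by linarith : 11 * √((R : ℝ) / ε) + 1 ≤ 12 * √(R / ε))) 2
    rw [mul_pow, Real.sq_sqrt (by positivity)] at h2
    linarith
  have hC : 0 < 8 / l₀ + 1 := by positivity
  -- The constant is `23232 = 48 * 22 ^ 2`. The next requirement needs only `48 * 144 = 6912`, with
  -- `1 / ε` in place of `1 / ε ^ 2`.
  have hpj : 48 * Fintype.card ι * p * 22 ^ 2 ≤ m := by
    have : (48 : ℝ) * Fintype.card ι * p * 22 ^ 2 ≤ m := by
      refine le_trans ?_ hm
      calc (48 : ℝ) * Fintype.card ι * p * 22 ^ 2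
          ≤ 48 * N * ((8 / l₀ + 1) * (R * l)) * 22 ^ 2 := by gcongr
        _ = 23232 * (8 / l₀ + 1) * (N * R * l / 1) := by ring
        _ ≤ 23232 * (8 / l₀ + 1) * (N * R * l / ε ^ 2) := by gcongr
    exact_mod_cast this
  have hqk : 48 * Fintype.card ι * q * k ^ 2 ≤ m := by
    have : (48 : ℝ) * Fintype.card ι * q * k ^ 2 ≤ m := by
      refine le_trans ?_ hm
      calc (48 : ℝ) * Fintype.card ι * q * k ^ 2
          ≤ 48 * N * ((8 / l₀ + 1) * l) * (144 * (R / ε)) := by gcongr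
        _ = 6912 * (8 / l₀ + 1) * (N * R * l / ε) := by ring
        _ ≤ 23232 * (8 / l₀ + 1) * (N * R * l / ε ^ 2) := by
          gcongr
          norm_num
    exact_mod_cast this
  refine (measure_sketchFailure_le hT L Y hε (Nat.ceil_pos.2 (by positivity)) (by norm_num)
    (Nat.ceil_pos.2 (by positivity)) (Nat.ceil_pos.2 (by positivity)) hpj hqk).trans ?_
  rw [← ENNReal.ofReal_add (by positivity) (by positivity)]
  refine ENNReal.ofReal_le_ofReal ?_
  have h1 := subspace_failure_le (R := R) (p := p) (Nat.le_ceil (3 + 4 * (R : ℝ) + l))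
  have h2 := product_failure_le (q := q) (k := k) hε hR (Nat.le_ceil _) (Nat.le_ceil (3 + l))
  linarith

end CPALS

/-! ### Assembly of the theorem -/

theorem theoremG1 (δ₀ : ℝ) (hδ₀ : δ₀ < 1) :
    ∃ C : ℝ, 0 < C ∧
      ∀ (N R s m : ℕ) (ε δ : ℝ), 0 < ε → ε ≤ 1 → 0 < δ → δ ≤ δ₀ →
        C * (N * R * Real.log (1 / δ) / ε ^ 2) ≤ m →
        ∀ (i : Fin N) (X : (Fin N → Fin s) → ℝ) (A : Fin N → Matrix (Fin s) (Fin R) ℝ)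
          (T : CPALS.SketchNetwork {j : Fin N // j ≠ i} m), T.IsContractionTree →
          T.law s {G | ¬ (
              (∃ B, CPALS.IsLsqSolution (T.embedding s G * CPALS.khatriRao A i)
                (T.embedding s G * CPALS.matricizationT X i) B) ∧
              ∀ B, CPALS.IsLsqSolution (T.embedding s G * CPALS.khatriRao A i)
                  (T.embedding s G * CPALS.matricizationT X i) B →
                CPALS.IsLsqAccurate ε (CPALS.khatriRao A i) (CPALS.matricizationT X i) B)}
            ≤ ENNReal.ofReal δ := by
  rcases le_or_gt δ₀ 0 with h0 | h0
  · exact ⟨1, one_pos, fun N R s m ε δ _ _ hδ hδ' => absurd (hδ.trans_le (hδ'.trans h0))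
      (lt_irrefl 0)⟩
  have hl₀ : 0 < Real.log (1 / δ₀) := Real.log_pos (by rw [lt_div_iff₀ h0]; linarith)
  refine ⟨23232 * (8 / Real.log (1 / δ₀) + 1), by positivity, ?_⟩
  intro N R s m ε δ hε hε1 hδ hδ' hm i X A T hT
  -- For `R = 0` the size condition is void and `m` may be `0`, so no probabilistic bound is
  -- available; but the unknown matrix has no columns and is unique, so failure is impossible.
  rcases Nat.eq_zero_or_pos R with rfl | hR
  · have hempty : {G | ¬ (
              (∃ B, CPALS.IsLsqSolution (T.embedding s G * CPALS.khatriRao A i)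
                (T.embedding s G * CPALS.matricizationT X i) B) ∧
              ∀ B, CPALS.IsLsqSolution (T.embedding s G * CPALS.khatriRao A i)
                  (T.embedding s G * CPALS.matricizationT X i) B →
                CPALS.IsLsqAccurate ε (CPALS.khatriRao A i) (CPALS.matricizationT X i) B)} =
        (∅ : Set (T.Sample s)) :=
      Set.eq_empty_of_forall_notMem fun G hG => hG ⟨CPALS.exists_isLsqSolution _ _,
        fun B _ => CPALS.isLsqAccurate_of_isEmpty hε.le _ _ B⟩
    rw [hempty, measure_empty]
    exact zero_le
  have hl : Real.log (1 / δ₀) ≤ Real.log (1 / δ) :=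
    Real.log_le_log (by positivity) (one_div_le_one_div_of_le hδ hδ')
  have hδe : δ = Real.exp (-Real.log (1 / δ)) := by
    rw [one_div, Real.log_inv, neg_neg, Real.exp_log hδ]
  rw [hδe]
  have hcard : Fintype.card {j : Fin N // j ≠ i} ≤ N :=
    (Fintype.card_subtype_le _).trans_eq (Fintype.card_fin N)
  exact CPALS.measure_sketchFailure_le_of_size hcard hT (CPALS.khatriRao A i)
    (CPALS.matricizationT X i) hR hε hε1 hl₀ hl hm
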